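/- Let $x\ge 0$, $q>0$, $c>0$, $\phi>1$. Let $X=\{X(t);t\ge 0\}$ be, under $\mathrm{P}_x$, a spectrally negative L\'evy process (c\`adl\`ag, stationary independent increments, no positive jumps) with $X(0)=x$ and natural filtration $\mathcal F$, which is neither a pure increasing linear drift nor the negative of a subordinator, and assume $\mathrm{E}_x|X(1)|<\infty$ (equivalently $\psi'(0+)>-\infty$ for the Laplace exponent $\psi$ of $X$). A strategy is a pair $(D,R)$ of $\mathcal F$-adapted non-decreasing processes with $D(0)=R(0)=0$, where $D$ (cumulative dividends) is left-continuous and pure jump, i.e. $D(t)=\sum_{s<t}\Delta D(s)$ with $\Delta D(s)=D(s+)-D(s)$, and $R$ (cumulative capital injections) is right-continuous with left limits. Its reserve process is $U(t)=X(t)-D(t)+R(t)$. The strategy is admissible, $(D,R)\in\mathcal D$, if $\mathrm{P}_x$-almost surely $U(t)\ge 0$ for all $t\ge0$ and $\int_0^\infty e^{-qt}\,\mathrm dR(t)<\infty$. Its value is $$V_{(D,R)}(x)=\mathrm{E}_x\Big(\sum_{t:\,\Delta D(t)>0}e^{-qt}(\Delta D(t)-c)-\phi\int_0^\infty e^{-qt}\,\mathrm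 dR(t)\Big)\in[-\infty,\infty).$$ Write $\Delta X(t)=X(t)-X(t-)$, with $X(0-)=X(0)$ and $U(0-)=U(0)$. Let $\mathcal D_1$ be the set of those $(D,R)\in\mathcal D$ for which, $\mathrm{P}_x$-almost surely, for all $t\ge 0$, $$\Delta D(t)>0 \iff c<\Delta D(t)\le U(t-)+\Delta X(t),\qquad R(t)=-\Big(\inf_{0\le s\le t}(X(s)-D(s))\wedge 0\Big).$$ Then every strategy outside $\mathcal D_1$ is strictly dominated by one in $\mathcal D_1$: for every $(D,R)\in\mathcal D\setminus\mathcal D_1$ there is $(\overline D,\overline R)\in\mathcal D_1$ with $V_{(D,R)}(x)<V_{(\overline D,\overline R)}(x)$. Consequently, every $(D,R)\in\mathcal D$ that attains $\sup_{\mathcal D}V_{(\cdot)}(x)$ belongs to $\mathcal D_1$, and $\sup_{(D,R)\in\mathcal D}V_{(D,R)}(x)=\sup_{(D,R)\in\mathcal D_1}V_{(D,R)}(x)$. -/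

import Mathlib

open MeasureTheory ProbabilityTheory Filter Topology Set
open scoped NNReal ENNReal

noncomputable section

namespace ImpulseDividend

variable {Ω : Type*} [mΩ : MeasurableSpace Ω]

/-- `X` is, under `P`, a spectrally negative Lévy process issued from `x`: càdlàg paths started
at `x`, stationary independent increments, no positive jumps; moreover `X` is neither a pure
increasing linear drift nor the negative of a subordinator. -/
structure IsSpectrallyNegativeLevy (X : ℝ≥0 → Ω → ℝ) (P : Measure Ω) (x : ℝ) : Prop where
  measurable : ∀ t, Measurable (X t)
  start : ∀ ω, X 0 ω = x
  right_continuous : ∀ ω t, ContinuousWithinAt (fun s => X s ω) (Ici t) t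
  left_limits : ∀ ω t, ∃ l : ℝ, Tendsto (fun s => X s ω) (𝓝[<] t) (𝓝 l)
  indep_increments : HasIndepIncrements X P
  stationary_increments : ∀ s h : ℝ≥0,
    P.map (fun ω => X (s + h) ω - X s ω) = P.map (fun ω => X h ω - X 0 ω)
  no_positive_jumps : ∀ᵐ ω ∂P, ∀ t, X t ω ≤ Function.leftLim (fun s => X s ω) t
  not_drift : ¬ ∃ δ : ℝ, 0 < δ ∧ ∀ᵐ ω ∂P, ∀ t : ℝ≥0, X t ω = x + δ * t
  not_neg_subordinator : ¬ ∀ᵐ ω ∂P, Antitone (fun t => X t ω)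

/-- The natural filtration of a process with measurable coordinates. -/
def naturalFiltration (X : ℝ≥0 → Ω → ℝ) (hX : ∀ t, Measurable (X t)) : Filtration ℝ≥0 mΩ :=
  Filtration.natural X fun t => (hX t).stronglyMeasurable

/-- An impulse dividend and capital injection strategy, adapted to the filtration `𝓕`.
`D t ω` is the cumulative dividend paid before time `t` (non-decreasing, left-continuous, pure
jump, `D 0 = 0`), `R t ω` is the cumulative capital injected up to time `t` (non-decreasing,
right-continuous, `R 0 = 0`; left limits exist by monotonicity). -/
structure Strategy (𝓕 : Filtration ℝ≥0 mΩ) where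
  /-- cumulative dividends -/
  D : ℝ≥0 → Ω → ℝ
  /-- cumulative capital injections -/
  R : ℝ≥0 → Ω → ℝ
  D_adapted : Adapted 𝓕 D
  D_zero : ∀ ω, D 0 ω = 0
  D_mono : ∀ ω, Monotone fun t => D t ω
  D_left_continuous : ∀ ω t, ContinuousWithinAt (fun s => D s ω) (Iic t) t
  D_pure_jump : ∀ ω (t : ℝ≥0),
    HasSum (fun s : Iio t => Function.rightLim (fun u => D u ω) s.1 - D s.1 ω) (D t ω)
  R_adapted : Adapted 𝓕 R
  R_zero : ∀ ω, R 0 ω = 0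
  R_mono : ∀ ω, Monotone fun t => R t ω
  R_right_continuous : ∀ ω t, ContinuousWithinAt (fun s => R s ω) (Ici t) t

namespace Strategy

variable {𝓕 : Filtration ℝ≥0 mΩ}

/-- The lump sum dividend `ΔD(t) = D(t+) - D(t)` paid at time `t`. -/
def lump (S : Strategy 𝓕) (t : ℝ≥0) (ω : Ω) : ℝ :=
  Function.rightLim (fun s => S.D s ω) t - S.D t ω

/-- The controlled reserve `U(t) = X(t) - D(t) + R(t)`. -/
def reserve (S : Strategy 𝓕) (X : ℝ≥0 → Ω → ℝ) (t : ℝ≥0) (ω : Ω) : ℝ :=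
  X t ω - S.D t ω + S.R t ω

/-- The path `t ↦ R t ω` as a Stieltjes function, giving the measure `dR`
(no mass at time `0`, since `R 0 = 0`). -/
def injection (S : Strategy 𝓕) (ω : Ω) : StieltjesFunction ℝ≥0 where
  toFun t := S.R t ω
  mono' := S.R_mono ω
  right_continuous' := S.R_right_continuous ω

/-- The discounted injected capital `∫₀^∞ e^{-qt} dR(t)`. -/
def discountedInjection (S : Strategy 𝓕) (q : ℝ) (ω : Ω) : ℝ≥0∞ :=
  ∫⁻ t : ℝ≥0, ENNReal.ofReal (Real.exp (-q * t)) ∂(S.injection ω).measure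

/-- The discounted dividends before transaction costs: the sum of `e^{-qτ} η` over all the payment
times `τ`, `η` being the amount paid at `τ` (the summand vanishes when nothing is paid). -/
def discountedDividends (S : Strategy 𝓕) (q : ℝ) (ω : Ω) : ℝ≥0∞ :=
  ∑' t : ℝ≥0, ENNReal.ofReal (Real.exp (-q * t) * S.lump t ω)

open Classical in
/-- The discounted transaction costs: the sum of `e^{-qτ} c` over all the payment times `τ`. -/
def discountedCosts (S : Strategy 𝓕) (q c : ℝ) (ω : Ω) : ℝ≥0∞ :=
  ∑' t : ℝ≥0, if 0 < S.lump t ω then ENNReal.ofReal (Real.exp (-q * t) * c) else 0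

/-- The net discounted payoff `∑ₙ e^{-qτₙ} (ηₙ - c) - φ ∫₀^∞ e^{-qt} dR(t)`, a number in
`[-∞, ∞)` whenever the discounted dividends are finite. -/
def payoff (S : Strategy 𝓕) (q c φ : ℝ) (ω : Ω) : EReal :=
  (S.discountedDividends q ω : EReal) -
    ((S.discountedCosts q c ω + ENNReal.ofReal φ * S.discountedInjection q ω : ℝ≥0∞) : EReal)

/-- The value of the strategy: the expectation of its payoff, as (expectation of the positive part)
minus (expectation of the negative part) in `[-∞, ∞]`. -/
def value (S : Strategy 𝓕) (P : Measure Ω) (q c φ : ℝ) : EReal :=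
  ((∫⁻ ω, (S.payoff q c φ ω).toENNReal ∂P : ℝ≥0∞) : EReal) -
    ((∫⁻ ω, (-(S.payoff q c φ ω)).toENNReal ∂P : ℝ≥0∞) : EReal)

/-- Admissibility: almost surely the reserve is non-negative at all times and
`∫₀^∞ e^{-qt} dR(t) < ∞`. -/
def IsAdmissible (S : Strategy 𝓕) (X : ℝ≥0 → Ω → ℝ) (P : Measure Ω) (q : ℝ) : Prop :=
  ∀ᵐ ω ∂P, (∀ t, 0 ≤ S.reserve X t ω) ∧ S.discountedInjection q ω < ∞

/-- `S` is admissible and, almost surely, `ΔD(t) > 0` iff `c < ΔD(t) ≤ U(t-) + ΔX(t)`, and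
`R(t) = -((inf_{s ≤ t} (X(s) - D(s))) ∧ 0)`, for all `t`. (A left limit at time `0` is the value
at time `0`.) -/
def IsReflected (S : Strategy 𝓕) (X : ℝ≥0 → Ω → ℝ) (P : Measure Ω) (q c : ℝ) : Prop :=
  S.IsAdmissible X P q ∧ ∀ᵐ ω ∂P, ∀ t,
    (0 < S.lump t ω ↔ c < S.lump t ω ∧
      S.lump t ω ≤ Function.leftLim (fun s => S.reserve X s ω) t
        + (X t ω - Function.leftLim (fun s => X s ω) t)) ∧
    S.R t ω = -(min (sInf ((fun s => X s ω - S.D s ω) '' Icc 0 t)) 0)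

end Strategy

/-- The class `𝒟` of admissible strategies. -/
def admissibleClass (𝓕 : Filtration ℝ≥0 mΩ) (X : ℝ≥0 → Ω → ℝ) (P : Measure Ω) (q : ℝ) :
    Set (Strategy 𝓕) :=
  {S | S.IsAdmissible X P q}

/-- The class `𝒟₁` of admissible strategies whose lump sums exceed `c` and never exceed the
available reserve, with capital injected by minimal reflection at `0`. -/
def reflectedClass (𝓕 : Filtration ℝ≥0 mΩ) (X : ℝ≥0 → Ω → ℝ) (P : Measure Ω) (q c : ℝ) :
    Set (Strategy 𝓕) :=
  {S | S.IsReflected X P q c}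

end ImpulseDividend

end

/-! Fix a path `y` of `X` and a dividend path `d`. A nonnegative reserve forces the injections up to
`t` to be at least `reg d y t`, the supremum over `s ≤ t` of the positive part of `d s - y s`. If
the lump sum at `u` overdraws the reserve, then `reg d y` jumps just after `u` by at least the
overdraft `excess d y u`. Cutting the overdraft off saves at least as much injected capital as it
loses in dividends, and this pays since `φ > 1`. If what remains of the lump is at most `c`, it
earns nothing after costs and is dropped. The dividends `trimmed`, with minimal injections, form a
strategy in 𝒟₁ whose payoff is almost surely at least the original one (`reg_trimmed_add_le`,
`isFeasible_trimmed`, `payoff_trimmed_le`). Discounting is handled by `e^{-qs} = P(T > s)` with `T`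
exponential of rate `q`: a discounted total is the mean of the cumulative path at `T`, so pointwise
inequalities between cumulative paths suffice.

For strictness, admissibility gives `D ≤ X + R`. The discounted running maximum of `|X|` has finite
mean, by Ottaviani's inequality, stationarity and integrability of `X 1`. Hence the positive part of
an admissible payoff has finite expectation. If the negative part has infinite expectation, the
value is `-∞` and never paying dividends is better. Otherwise equality of the two values forces
almost sure equality of payoffs, and then `R` is minimal for the trimmed dividends, no lump has an
excess, and every lump is at least `c` (`eq_of_payoff_eq`).

There remain lumps of exactly `c`. Such a payment is neutral in itself but lowers the reserve from
then on. If omitting it never changes the injections, the path can never fall below `-reg d y t`,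
for any `t` after the payment (`le_reg_of_lump_eq`). The increment of `X` after `t` is independent
of the past and falls below any level with positive probability (`exists_measure_increment_lt_pos`),
so almost surely there is no such lump. The fall is possible because otherwise the paths would be
nondecreasing, hence continuous in the absence of positive jumps, hence deterministic, hence linear
or constant, and both are excluded.

The trimmed dividends must be adapted to the natural filtration itself, without completion. They are
therefore defined for every `ω`, and sums over the uncountable set of times are shown measurable by
reading them as integrals against a kernel. -/

noncomputable section

namespace ImpulseDividend

/-! ### Sums of jumps -/

section JumpSum

/-- The cumulative sum `∑_{s < t} p s`. -/
def jumpSum (p : ℝ≥0 → ℝ) (t : ℝ≥0) : ℝ := ∑' s, (Iio t).indicator p s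

/-- Jump sizes that are non-negative and summable over bounded time intervals. -/
structure IsJumpFamily (p : ℝ≥0 → ℝ) : Prop where
  nonneg : ∀ s, 0 ≤ p s
  summable : ∀ t, Summable ((Iio t).indicator p)

namespace IsJumpFamily

variable {p p' : ℝ≥0 → ℝ}

lemma of_le (hp : IsJumpFamily p) (h0 : ∀ s, 0 ≤ p' s) (h : ∀ s, p' s ≤ p s) :
    IsJumpFamily p' :=
  ⟨h0, fun t => (hp.summable t).of_nonneg_of_le (fun s => indicator_nonneg (fun s _ => h0 s) s)
    (fun s => indicator_le_indicator (h s))⟩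

lemma jumpSum_nonneg (hp : IsJumpFamily p) (t : ℝ≥0) : 0 ≤ jumpSum p t :=
  tsum_nonneg fun s => indicator_nonneg (fun s _ => hp.nonneg s) s

lemma mono (hp : IsJumpFamily p) : Monotone (jumpSum p) := fun _ _ h =>
  (hp.summable _).tsum_le_tsum
    (fun s => indicator_le_indicator_of_subset (Iio_subset_Iio h) hp.nonneg s) (hp.summable _)

lemma jumpSum_le_jumpSum (hp : IsJumpFamily p) (hp' : IsJumpFamily p') (h : ∀ s, p s ≤ p' s)
    (t : ℝ≥0) : jumpSum p t ≤ jumpSum p' t :=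
  (hp.summable _).tsum_le_tsum (fun s => indicator_le_indicator (h s)) (hp'.summable _)

lemma jumpSum_add (hp : IsJumpFamily p) (hp' : IsJumpFamily p') (t : ℝ≥0) :
    jumpSum (fun s => p s + p' s) t = jumpSum p t + jumpSum p' t := by
  unfold jumpSum
  rw [← (hp.summable t).tsum_add (hp'.summable t)]
  congr 1
  ext s
  exact congrFun (indicator_add (Iio t) p p') s

lemma continuousWithinAt_Iic (hp : IsJumpFamily p) (t : ℝ≥0) :
    ContinuousWithinAt (jumpSum p) (Iic t) t := by
  refine tendsto_tsum_of_dominated_convergence (hp.summable t) (fun s => ?_) ?_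
  · refine tendsto_const_nhds.congr' ?_
    by_cases hs : s < t
    · filter_upwards [mem_nhdsWithin_of_mem_nhds (Ioi_mem_nhds hs)] with u hu
      rw [indicator_of_mem (by exact hs), indicator_of_mem (by exact hu)]
    · filter_upwards [self_mem_nhdsWithin] with u hu
      rw [indicator_of_notMem (by exact hs),
        indicator_of_notMem (by simpa using hu.trans (not_lt.1 hs))]
  · filter_upwards [self_mem_nhdsWithin] with u hu s
    rw [Real.norm_of_nonneg (indicator_nonneg (fun s _ => hp.nonneg s) s)]
    exact indicator_le_indicator_of_subset (Iio_subset_Iio hu) hp.nonneg s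

lemma tendsto_Ioi (hp : IsJumpFamily p) (t : ℝ≥0) :
    Tendsto (jumpSum p) (𝓝[>] t) (𝓝 (jumpSum p t + p t)) := by
  have h1 : jumpSum p t + p t = ∑' s, (Iic t).indicator p s := by
    have h2 : (Iic t).indicator p = fun s => (Iio t).indicator p s + ({t} : Set ℝ≥0).indicator p s := by
      ext s
      rcases lt_trichotomy s t with h | h | h
      · simp [h, h.le, h.ne]
      · simp [h]
      · simp [h.not_ge, h.not_gt, h.ne']
    have h3 : HasSum (({t} : Set ℝ≥0).indicator p) (p t) := by
      have := hasSum_single (f := ({t} : Set ℝ≥0).indicator p) t fun s hs => by simp [hs]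
      simpa using this
    rw [h2, ((hp.summable t).tsum_add h3.summable), h3.tsum_eq]
    rfl
  rw [h1]
  refine tendsto_tsum_of_dominated_convergence (hp.summable (t + 1)) (fun s => ?_) ?_
  · refine tendsto_const_nhds.congr' ?_
    by_cases hs : s ≤ t
    · filter_upwards [self_mem_nhdsWithin] with u hu
      rw [indicator_of_mem (by exact hs), indicator_of_mem (by exact hs.trans_lt hu)]
    · filter_upwards [mem_nhdsWithin_of_mem_nhds (Iio_mem_nhds (not_le.1 hs))] with u hu
      rw [indicator_of_notMem (by exact hs), indicator_of_notMem (by simpa using le_of_lt hu)]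
  · filter_upwards [mem_nhdsWithin_of_mem_nhds (Iio_mem_nhds (lt_add_one t))] with u hu s
    rw [Real.norm_of_nonneg (indicator_nonneg (fun s _ => hp.nonneg s) s)]
    exact indicator_le_indicator_of_subset (Iio_subset_Iio (le_of_lt hu)) hp.nonneg s

lemma rightLim_jumpSum (hp : IsJumpFamily p) (t : ℝ≥0) :
    Function.rightLim (jumpSum p) t = jumpSum p t + p t :=
  rightLim_eq_of_tendsto (hp.tendsto_Ioi t)

lemma hasSum_Iio (hp : IsJumpFamily p) (t : ℝ≥0) :
    HasSum (fun s : Iio t => p s) (jumpSum p t) :=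
  (hasSum_subtype_iff_indicator (f := p) (s := Iio t)).2 (hp.summable t).hasSum

end IsJumpFamily

lemma jumpSum_zero_time (p : ℝ≥0 → ℝ) : jumpSum p 0 = 0 := by
  simp [jumpSum]

end JumpSum

/-- The jump `f(s+) - f(s)`. -/
def jumpAt (f : ℝ≥0 → ℝ) (s : ℝ≥0) : ℝ := Function.rightLim f s - f s

lemma jumpAt_nonneg {f : ℝ≥0 → ℝ} (hf : Monotone f) (s : ℝ≥0) : 0 ≤ jumpAt f s :=
  sub_nonneg.2 (hf.le_rightLim le_rfl)

lemma sum_jumpAt_le {f : ℝ≥0 → ℝ} (hf : Monotone f) {s : ℝ≥0} (A : Finset ℝ≥0) :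
    ∀ t, s ≤ t → (∀ u ∈ A, s ≤ u ∧ u < t) → ∑ u ∈ A, jumpAt f u ≤ f t - f s := by
  induction A using Finset.induction_on_max with
  | empty => intro t ht _; simpa using hf ht
  | insert a A ha ih =>
    intro t ht h
    have h1 := h a (Finset.mem_insert_self _ _)
    have h2 := ih a h1.1 fun u hu => ⟨(h u (Finset.mem_insert_of_mem hu)).1, ha u hu⟩
    rw [Finset.sum_insert fun h => (ha a h).false]
    have h3 := hf.rightLim_le h1.2
    unfold jumpAt at *
    linarith

/-- A monotone function grows over `[s, t)` by at least any finite sum of its jumps there. It is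
applied with `f` the dividends and with `f` the minimal injections, whose right jumps dominate the
excesses. -/
lemma jumpSum_sub_le {f p : ℝ≥0 → ℝ} (hf : Monotone f) (hp : IsJumpFamily p)
    (h : ∀ u, p u ≤ jumpAt f u) {s t : ℝ≥0} (hst : s ≤ t) :
    jumpSum p t - jumpSum p s ≤ f t - f s := by
  rw [sub_le_iff_le_add']
  refine (hp.summable t).tsum_le_of_sum_le fun A => ?_
  have h1 : ∀ u, (Iio t).indicator p u = (Iio s).indicator p u + (Ico s t).indicator p u := by
    intro u
    by_cases h1 : u < s
    · simp [h1, h1.trans_le hst, h1.not_ge]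
    · by_cases h2 : u < t <;> simp [h1, h2, not_lt.1 h1]
  simp_rw [h1, Finset.sum_add_distrib]
  refine add_le_add ((hp.summable s).sum_le_tsum _
    fun u _ => indicator_nonneg (fun s _ => hp.nonneg s) u) ?_
  classical
  calc ∑ u ∈ A, (Ico s t).indicator p u = ∑ u ∈ A with u ∈ Ico s t, p u := by
        simp [Finset.sum_filter, indicator_apply]
    _ ≤ ∑ u ∈ A with u ∈ Ico s t, jumpAt f u := Finset.sum_le_sum fun u _ => h u
    _ ≤ _ := sum_jumpAt_le hf _ t hst fun u hu => (Finset.mem_filter.1 hu).2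

/-- A non-decreasing left-continuous pure jump path starting at `0`. -/
structure IsDividendPath (d : ℝ≥0 → ℝ) : Prop where
  zero : d 0 = 0
  mono : Monotone d
  left_continuous : ∀ t, ContinuousWithinAt d (Iic t) t
  pure_jump : ∀ t : ℝ≥0, HasSum (fun s : Iio t => Function.rightLim d s.1 - d s.1) (d t)

namespace IsDividendPath

variable {d : ℝ≥0 → ℝ}

lemma hasSum_indicator (hd : IsDividendPath d) (t : ℝ≥0) :
    HasSum ((Iio t).indicator (jumpAt d)) (d t) :=
  (hasSum_subtype_iff_indicator (f := jumpAt d) (s := Iio t)).1 (hd.pure_jump t)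

lemma isJumpFamily (hd : IsDividendPath d) : IsJumpFamily (jumpAt d) :=
  ⟨jumpAt_nonneg hd.mono, fun t => (hd.hasSum_indicator t).summable⟩

lemma jumpSum_jumpAt (hd : IsDividendPath d) : jumpSum (jumpAt d) = d :=
  funext fun t => (hd.hasSum_indicator t).tsum_eq

lemma nonneg (hd : IsDividendPath d) (t : ℝ≥0) : 0 ≤ d t := hd.zero ▸ hd.mono zero_le

end IsDividendPath

lemma IsJumpFamily.jumpAt_jumpSum {p : ℝ≥0 → ℝ} (hp : IsJumpFamily p) :
    jumpAt (jumpSum p) = p := by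
  ext t
  rw [jumpAt, hp.rightLim_jumpSum]
  ring

lemma IsJumpFamily.isDividendPath {p : ℝ≥0 → ℝ} (hp : IsJumpFamily p) :
    IsDividendPath (jumpSum p) where
  zero := jumpSum_zero_time p
  mono := hp.mono
  left_continuous := hp.continuousWithinAt_Iic
  pure_jump t := by
    have h : ∀ s, Function.rightLim (jumpSum p) s - jumpSum p s = p s :=
      fun s => congrFun hp.jumpAt_jumpSum s
    simp_rw [h]
    exact hp.hasSum_Iio t

/-! ### Minimal capital injection -/

/-- Right-continuous paths with left limits. -/
structure IsCadlagPath (y : ℝ≥0 → ℝ) : Prop where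
  right_continuous : ∀ t, ContinuousWithinAt y (Ici t) t
  left_limits : ∀ t, ∃ l : ℝ, Tendsto y (𝓝[<] t) (𝓝 l)

/-- The one-sided limits make the path bounded near each point; compactness of `[0, t]` does the
rest. -/
lemma IsCadlagPath.exists_abs_le {y : ℝ≥0 → ℝ} (hy : IsCadlagPath y) (t : ℝ≥0) :
    ∃ b : ℝ, ∀ s ≤ t, |y s| ≤ b := by
  have key : ∃ b : ℝ, ∀ s ∈ Icc 0 t, |y s| ≤ b := by
    refine isCompact_Icc.induction_on (p := fun A => ∃ b : ℝ, ∀ s ∈ A, |y s| ≤ b) ⟨0, by simp⟩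
      (fun A B hAB ⟨b, hb⟩ => ⟨b, fun s hs => hb s (hAB hs)⟩)
      (fun A B ⟨a, ha⟩ ⟨b, hb⟩ => ⟨max a b, ?_⟩) (fun s _ => ?_)
    · rintro s (hs | hs)
      · exact (ha s hs).trans (le_max_left _ _)
      · exact (hb s hs).trans (le_max_right _ _)
    · obtain ⟨l, hl⟩ := hy.left_limits s
      have h1 : ∀ᶠ u in 𝓝[<] s, |y u| < |l| + 1 :=
        hl.abs.eventually (Iio_mem_nhds (lt_add_one _))
      have h2 : ∀ᶠ u in 𝓝[≥] s, |y u| < |y s| + 1 :=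
        (hy.right_continuous s).abs.eventually (Iio_mem_nhds (lt_add_one _))
      have h3 : ∀ᶠ u in 𝓝 s, |y u| ≤ max (|l| + 1) (|y s| + 1) := by
        rw [← nhdsLT_sup_nhdsGE s, eventually_sup]
        exact ⟨h1.mono fun u hu => hu.le.trans (le_max_left _ _),
          h2.mono fun u hu => hu.le.trans (le_max_right _ _)⟩
      exact ⟨_, mem_nhdsWithin_of_mem_nhds h3, _, fun u hu => hu⟩
  obtain ⟨b, hb⟩ := key
  exact ⟨b, fun s hs => hb s ⟨zero_le, hs⟩⟩

/-- The minimal cumulative injection `-((inf_{s ≤ t} (y s - d s)) ∧ 0)` for the path `y` and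
dividends `d`. -/
def reg (d y : ℝ≥0 → ℝ) (t : ℝ≥0) : ℝ := -(min (sInf ((fun s => y s - d s) '' Icc 0 t)) 0)

section Reg

variable {d y : ℝ≥0 → ℝ}

lemma reg_nonneg (t : ℝ≥0) : 0 ≤ reg d y t := neg_nonneg.2 (min_le_right _ _)

lemma le_reg (hd : Monotone d) (hy : IsCadlagPath y) {s t : ℝ≥0} (hst : s ≤ t) :
    d s - y s ≤ reg d y t := by
  obtain ⟨b, hb⟩ := hy.exists_abs_le t
  have hbdd : BddBelow ((fun s => y s - d s) '' Icc 0 t) := by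
    refine ⟨-b - d t, ?_⟩
    rintro _ ⟨u, hu, rfl⟩
    have h1 := (abs_le.1 (hb u hu.2)).1
    have h2 := hd hu.2
    simp only
    linarith
  have h1 : sInf ((fun s => y s - d s) '' Icc 0 t) ≤ y s - d s :=
    csInf_le hbdd ⟨s, ⟨zero_le, hst⟩, rfl⟩
  have h2 := (min_le_left (sInf ((fun s => y s - d s) '' Icc 0 t)) 0).trans h1
  rw [reg]
  linarith

/-- Together with `le_reg` and `reg_nonneg`, this characterises `reg d y t` as the least nonnegative
bound of `d - y` on `[0, t]`, which is how most later arguments use it. -/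
lemma reg_le {t : ℝ≥0} {b : ℝ} (hb : 0 ≤ b) (h : ∀ s ≤ t, d s - y s ≤ b) : reg d y t ≤ b := by
  rw [reg, neg_le]
  refine le_min (le_csInf ⟨_, 0, ⟨le_rfl, zero_le⟩, rfl⟩ ?_) (by linarith)
  rintro _ ⟨s, hs, rfl⟩
  have := h s hs.2
  simp only
  linarith

lemma reg_congr {d' y' : ℝ≥0 → ℝ} {t : ℝ≥0} (h : ∀ s ≤ t, d s = d' s ∧ y s = y' s) :
    reg d y t = reg d' y' t := by
  unfold reg
  congr 3
  exact image_congr fun s hs => by rw [(h s hs.2).1, (h s hs.2).2]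

lemma reg_mono (hd : Monotone d) (hy : IsCadlagPath y) : Monotone (reg d y) := fun _ _ h =>
  reg_le (reg_nonneg _) fun _ hs => le_reg hd hy (hs.trans h)

lemma reg_zero (hd : d 0 = 0) (hy : 0 ≤ y 0) : reg d y 0 = 0 := by
  simp [reg, hd, hy]

lemma rightLim_sub_le_rightLim_reg (hd : Monotone d) (hy : IsCadlagPath y) (t : ℝ≥0) :
    Function.rightLim d t - y t ≤ Function.rightLim (reg d y) t := by
  have h1 := hd.tendsto_rightLim t
  have h2 := (reg_mono hd hy).tendsto_rightLim t
  have h3 : Tendsto y (𝓝[>] t) (𝓝 (y t)) :=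
    (hy.right_continuous t).mono_left (nhdsWithin_mono _ Ioi_subset_Ici_self)
  exact le_of_tendsto_of_tendsto' (h1.sub h3) h2 fun s => le_reg hd hy le_rfl

/-- As `d` is only left-continuous, a lump at `t` is felt just after `t` and may make `reg` jump
there. The hypothesis says that the lump does not overdraw the reserve, which rules this out. -/
lemma reg_right_continuous (hd : Monotone d) (hy : IsCadlagPath y) {t : ℝ≥0}
    (h : Function.rightLim d t - y t ≤ reg d y t) : ContinuousWithinAt (reg d y) (Ici t) t := by
  refine tendsto_order.2 ⟨fun a ha => ?_, fun a ha => ?_⟩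
  · filter_upwards [self_mem_nhdsWithin] with u hu
    exact ha.trans_le (reg_mono hd hy hu)
  · have h1 : Tendsto (fun s => d s - y s) (𝓝[>] t) (𝓝 (Function.rightLim d t - y t)) :=
      (hd.tendsto_rightLim t).sub
        ((hy.right_continuous t).mono_left (nhdsWithin_mono _ Ioi_subset_Ici_self))
    obtain ⟨a', ha', haa⟩ := exists_between ha
    have h2 := h1.eventually (Iio_mem_nhds (h.trans_lt ha'))
    obtain ⟨b, hb, hb'⟩ := (mem_nhdsGT_iff_exists_Ioo_subset' (lt_add_one t)).1 h2
    filter_upwards [mem_nhdsWithin_of_mem_nhds (Iio_mem_nhds hb)] with u hu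
    refine (reg_le (b := a') ((reg_nonneg t).trans ha'.le) fun s hs => ?_).trans_lt haa
    rcases le_or_gt s t with hst | hst
    · exact (le_reg hd hy hst).trans ha'.le
    · exact le_of_lt (hb' ⟨hst, hs.trans_lt hu⟩)

lemma reg_le_of_reserve_nonneg {r : ℝ≥0 → ℝ} (hr : Monotone r) (hr0 : r 0 = 0)
    (h : ∀ t, 0 ≤ y t - d t + r t) (t : ℝ≥0) : reg d y t ≤ r t :=
  reg_le (hr0 ▸ hr zero_le) fun s hs => by linarith [h s, hr hs]

end Reg

/-! ### The trimmed dividends -/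

/-- The part of the lump sum at time `u` that has to be financed by injected capital. -/
def excess (d y : ℝ≥0 → ℝ) (u : ℝ≥0) : ℝ := max 0 (Function.rightLim d u - y u - reg d y u)

/-- The lump sum at time `u` without the part financed by injected capital, omitted if it does not
exceed `c`. -/
def trimmed (c : ℝ) (d y : ℝ≥0 → ℝ) (u : ℝ≥0) : ℝ :=
  if c < jumpAt d u - excess d y u then jumpAt d u - excess d y u else 0

section Trimmed

variable {c : ℝ} {d y : ℝ≥0 → ℝ}

lemma excess_nonneg (u : ℝ≥0) : 0 ≤ excess d y u := le_max_left _ _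

/-- The overdrawn part of a lump must be injected at once, so it is visible as a right jump of the
minimal injection. -/
lemma excess_le_jumpAt_reg (hd : Monotone d) (hy : IsCadlagPath y) (u : ℝ≥0) :
    excess d y u ≤ jumpAt (reg d y) u :=
  max_le (jumpAt_nonneg (reg_mono hd hy) u)
    (sub_le_sub_right (rightLim_sub_le_rightLim_reg hd hy u) _)

lemma excess_le_jumpAt (hd : Monotone d) (hy : IsCadlagPath y) (u : ℝ≥0) :
    excess d y u ≤ jumpAt d u := by
  refine max_le (jumpAt_nonneg hd u) ?_
  have := le_reg hd hy (le_refl u)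
  rw [jumpAt]
  linarith

lemma isJumpFamily_excess (hd : IsDividendPath d) (hy : IsCadlagPath y) :
    IsJumpFamily (excess d y) :=
  hd.isJumpFamily.of_le excess_nonneg (excess_le_jumpAt hd.mono hy)

lemma trimmed_nonneg (hc : 0 < c) (u : ℝ≥0) : 0 ≤ trimmed c d y u := by
  unfold trimmed
  split_ifs with h
  · exact (hc.trans h).le
  · exact le_rfl

lemma trimmed_le (hd : Monotone d) (hy : IsCadlagPath y) (u : ℝ≥0) :
    trimmed c d y u ≤ jumpAt d u - excess d y u := by
  unfold trimmed
  split_ifs with h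
  · exact le_rfl
  · exact sub_nonneg.2 (excess_le_jumpAt hd hy u)

lemma trimmed_le_jumpAt (hd : Monotone d) (hy : IsCadlagPath y) (u : ℝ≥0) :
    trimmed c d y u ≤ jumpAt d u :=
  (trimmed_le hd hy u).trans (sub_le_self _ (excess_nonneg u))

lemma lt_trimmed_of_pos {u : ℝ≥0} (h : 0 < trimmed c d y u) : c < trimmed c d y u := by
  unfold trimmed at *
  split_ifs at * with h1
  · exact h1
  · exact absurd h (lt_irrefl _)

lemma isJumpFamily_trimmed (hc : 0 < c) (hd : IsDividendPath d) (hy : IsCadlagPath y) :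
    IsJumpFamily (trimmed c d y) :=
  hd.isJumpFamily.of_le (trimmed_nonneg hc) (trimmed_le_jumpAt hd.mono hy)

lemma monotone_sub_jumpSum {p : ℝ≥0 → ℝ} (hd : IsDividendPath d) (hp : IsJumpFamily p)
    (h : ∀ u, p u ≤ jumpAt d u) : Monotone fun t => d t - jumpSum p t := fun s t hst => by
  have := jumpSum_sub_le hd.mono hp h hst
  simp only
  linarith

lemma jumpSum_le {p : ℝ≥0 → ℝ} (hd : IsDividendPath d) (hp : IsJumpFamily p)
    (h : ∀ u, p u ≤ jumpAt d u) (t : ℝ≥0) : jumpSum p t ≤ d t := by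
  have := monotone_sub_jumpSum hd hp h (zero_le (a := t))
  simp only [hd.zero, jumpSum_zero_time, sub_zero, sub_nonneg] at this
  exact this

/-- Trimming the dividends saves at least as much injected capital as was paid in excess. -/
lemma reg_trimmed_add_le (hc : 0 < c) (hd : IsDividendPath d) (hy : IsCadlagPath y)
    (hy0 : 0 ≤ y 0) (t : ℝ≥0) :
    reg (jumpSum (trimmed c d y)) y t + jumpSum (excess d y) t ≤ reg d y t := by
  have hF := isJumpFamily_excess hd hy
  have hp := isJumpFamily_trimmed hc hd hy
  have key : ∀ s ≤ t, jumpSum (excess d y) t - jumpSum (excess d y) s ≤ reg d y t - reg d y s :=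
    fun s hs => jumpSum_sub_le (reg_mono hd.mono hy) hF (excess_le_jumpAt_reg hd.mono hy) hs
  rw [← le_sub_iff_add_le]
  refine reg_le ?_ fun s hs => ?_
  -- With `e` the trimmed dividends and `F` the accumulated excess, the chain for `s ≤ t` is `e s -
  -- y s ≤ d s - F s - y s ≤ reg d y s - F s ≤ reg d y t - F t`. The present case is nonnegativity
  -- of the last bound.
  · have := key 0 zero_le
    rw [reg_zero hd.zero hy0, jumpSum_zero_time] at this
    linarith
  · have h1 : jumpSum (trimmed c d y) s + jumpSum (excess d y) s ≤ d s := by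
      rw [← hp.jumpSum_add hF]
      conv_rhs => rw [← hd.jumpSum_jumpAt]
      refine IsJumpFamily.jumpSum_le_jumpSum ?_ hd.isJumpFamily (fun u => ?_) s
      · refine hd.isJumpFamily.of_le
          (fun u => add_nonneg (trimmed_nonneg hc u) (excess_nonneg u)) fun u => ?_
        linarith [trimmed_le (c := c) hd.mono hy u]
      · linarith [trimmed_le (c := c) hd.mono hy u]
    have h2 := le_reg hd.mono hy (le_refl s)
    linarith [key s hs]

lemma trimmed_add_reg_le {u : ℝ≥0} (hu : 0 < trimmed c d y u) :
    trimmed c d y u ≤ y u - d u + reg d y u := by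
  unfold trimmed at *
  split_ifs at * with h
  · have := le_max_right 0 (Function.rightLim d u - y u - reg d y u)
    rw [← excess] at this
    rw [jumpAt]
    linarith
  · exact absurd hu (lt_irrefl _)

/-- A payment is feasible if it does not exceed the reserve just before it. -/
def IsFeasible (d y : ℝ≥0 → ℝ) : Prop :=
  ∀ t, 0 < jumpAt d t → jumpAt d t ≤ y t - d t + Function.leftLim (reg d y) t

/-- A trimmed lump fits into the reserve `y t - d t + reg d y t` of the original dividends. Since `d
- e` is nondecreasing, paying less before `t` saves at most `d t - e t` of injections, so the
reserve available under `e` is no smaller. -/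
lemma isFeasible_trimmed (hc : 0 < c) (hd : IsDividendPath d) (hy : IsCadlagPath y) :
    IsFeasible (jumpSum (trimmed c d y)) y := by
  have hp := isJumpFamily_trimmed hc hd hy
  have hle := trimmed_le_jumpAt (c := c) hd.mono hy
  set e := jumpSum (trimmed c d y) with he
  have hm := reg_mono hp.mono hy
  intro t ht
  rw [hp.jumpAt_jumpSum] at ht ⊢
  have h1 := trimmed_add_reg_le ht
  have hB : 0 ≤ Function.leftLim (reg e y) t :=
    (reg_nonneg 0).trans (by
      rcases eq_or_lt_of_le (zero_le (a := t)) with h | h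
      · rw [← h, leftLim_eq_of_isBot (a := (0 : ℝ≥0)) isBot_bot]
      · exact hm.le_leftLim h)
  have hde : 0 ≤ d t - e t := sub_nonneg.2 (jumpSum_le hd hp hle t)
  have h2 : reg d y t ≤ max (d t - y t) (Function.leftLim (reg e y) t + (d t - e t)) := by
    refine reg_le (le_max_of_le_right (add_nonneg hB hde)) fun s hs => ?_
    rcases hs.eq_or_lt with rfl | hs
    · exact le_max_left _ _
    · refine le_max_of_le_right ?_
      have h3 := monotone_sub_jumpSum hd hp hle hs.le
      have h4 := (le_reg hp.mono hy (le_refl s)).trans (hm.le_leftLim hs)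
      simp only [← he] at h3 h4
      linarith
  -- In the first case `h1` would give a nonpositive lump, against `ht`; the second case is the
  -- claim.
  rcases le_max_iff.1 h2 with h | h
  · linarith
  · linarith

lemma IsFeasible.rightLim_sub_le (h : IsFeasible d y) (hd : Monotone d) (hy : IsCadlagPath y)
    (t : ℝ≥0) : Function.rightLim d t - y t ≤ reg d y t := by
  rcases (jumpAt_nonneg hd t).eq_or_lt with h0 | h0
  · have := le_reg hd hy (le_refl t)
    rw [jumpAt] at h0
    linarith
  · have h1 := h t h0
    have h2 := (reg_mono hd hy).leftLim_le (le_refl t)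
    rw [jumpAt] at h1
    linarith

/-- Left continuity of `d` turns the bound `U(t-) + ΔX(t)` of 𝒟₁ into the one used in `IsFeasible`.
-/
lemma leftLim_reserve_add_jump {r : ℝ≥0 → ℝ} (hd : ∀ t, ContinuousWithinAt d (Iic t) t)
    (hy : IsCadlagPath y) (hr : Monotone r) (t : ℝ≥0) :
    Function.leftLim (fun s => y s - d s + r s) t + (y t - Function.leftLim y t)
      = y t - d t + Function.leftLim r t := by
  rcases eq_or_lt_of_le (zero_le (a := t)) with h | h
  · subst h
    have hb : IsBot (0 : ℝ≥0) := isBot_bot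
    rw [leftLim_eq_of_isBot hb, leftLim_eq_of_isBot hb, leftLim_eq_of_isBot hb]
    ring
  · have hne : (𝓝[<] t).NeBot := nhdsLT_neBot_of_exists_lt ⟨0, h⟩
    obtain ⟨l, hl⟩ := hy.left_limits t
    have h1 : Tendsto d (𝓝[<] t) (𝓝 (d t)) := (hd t).mono_left (nhdsWithin_mono _ Iio_subset_Iic_self)
    rw [leftLim_eq_of_tendsto hl,
      leftLim_eq_of_tendsto ((hl.sub h1).add (hr.tendsto_leftLim t))]
    ring

end Trimmed

/-! ### Joint measurability -/

section Measurability

variable {Ω : Type*} {m : MeasurableSpace Ω}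

/-- Joint measurability by time discretisation. The grid point is taken strictly after `s` for
right-continuous processes and at or before `s` for left-continuous ones. -/
lemma measurable_of_tendsto_grid {f : ℝ≥0 → Ω → ℝ} (hf : ∀ t, Measurable (f t))
    (k : ℕ → ℝ≥0 → ℕ) (hk : ∀ n, Measurable (k n))
    (h : ∀ s ω, Tendsto (fun n : ℕ => f (k n s / (n + 1)) ω) atTop (𝓝 (f s ω))) :
    Measurable fun z : ℝ≥0 × Ω => f z.1 z.2 := by
  refine measurable_of_tendsto_metrizable (f := fun (n : ℕ) (z : ℝ≥0 × Ω) =>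
    f (k n z.1 / (n + 1)) z.2) (fun n => ?_) (tendsto_pi_nhds.2 fun z => h z.1 z.2)
  have h1 : Measurable fun w : ℕ × Ω => f ((w.1 : ℝ≥0) / (n + 1)) w.2 :=
    measurable_from_prod_countable_right fun j => hf ((j : ℝ≥0) / (n + 1))
  exact h1.comp (((hk n).comp measurable_fst).prodMk measurable_snd)

lemma measurable_uncurry_of_right_continuous {f : ℝ≥0 → Ω → ℝ} (hf : ∀ t, Measurable (f t))
    (hc : ∀ ω t, ContinuousWithinAt (fun s => f s ω) (Ici t) t) :
    Measurable fun z : ℝ≥0 × Ω => f z.1 z.2 := by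
  refine measurable_of_tendsto_grid hf (fun n s => ⌊s * (n + 1)⌋₊ + 1)
    (fun n => (Nat.measurable_floor.comp (measurable_id.mul_const _)).add_const 1) fun s ω => ?_
  refine (hc ω s).tendsto.comp (tendsto_nhdsWithin_iff.2 ⟨?_, Eventually.of_forall fun n => ?_⟩)
  · refine tendsto_of_tendsto_of_tendsto_of_le_of_le (g := fun _ => s)
      (h := fun n : ℕ => s + 1 / ((n : ℝ≥0) + 1)) tendsto_const_nhds ?_ (fun n => ?_) (fun n => ?_)
    · simpa using tendsto_const_nhds.add (tendsto_one_div_add_atTop_nhds_zero_nat (𝕜 := ℝ≥0))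
    · simp only
      rw [le_div_iff₀ (by positivity)]
      push_cast
      exact (Nat.lt_floor_add_one _).le
    · simp only
      rw [div_le_iff₀ (by positivity), add_mul, one_div, inv_mul_cancel₀ (by positivity)]
      push_cast
      gcongr
      exact Nat.floor_le zero_le
  · simp only [mem_Ici]
    rw [le_div_iff₀ (by positivity)]
    push_cast
    exact (Nat.lt_floor_add_one _).le

lemma measurable_uncurry_of_left_continuous {f : ℝ≥0 → Ω → ℝ} (hf : ∀ t, Measurable (f t))
    (hc : ∀ ω t, ContinuousWithinAt (fun s => f s ω) (Iic t) t) :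
    Measurable fun z : ℝ≥0 × Ω => f z.1 z.2 := by
  refine measurable_of_tendsto_grid hf (fun n s => ⌊s * (n + 1)⌋₊)
    (fun n => Nat.measurable_floor.comp (measurable_id.mul_const _)) fun s ω => ?_
  refine (hc ω s).tendsto.comp (tendsto_nhdsWithin_iff.2 ⟨?_, Eventually.of_forall fun n => ?_⟩)
  · refine tendsto_of_tendsto_of_tendsto_of_le_of_le (g := fun n : ℕ => s - 1 / ((n : ℝ≥0) + 1))
      (h := fun _ => s) ?_ tendsto_const_nhds (fun n => ?_) (fun n => ?_)
    · simpa using tendsto_const_nhds.sub (tendsto_one_div_add_atTop_nhds_zero_nat (𝕜 := ℝ≥0))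
    · simp only
      rw [tsub_le_iff_right, ← add_div, le_div_iff₀ (by positivity)]
      exact (Nat.lt_floor_add_one _).le
    · simp only
      rw [div_le_iff₀ (by positivity)]
      exact Nat.floor_le zero_le
  · simp only [mem_Iic]
    rw [div_le_iff₀ (by positivity)]
    exact Nat.floor_le zero_le

lemma measurable_uncurry_rightLim {f : ℝ≥0 → Ω → ℝ} (hf : ∀ t, Measurable (f t))
    (hc : ∀ ω t, ContinuousWithinAt (fun s => f s ω) (Iic t) t)
    (hm : ∀ ω, Monotone fun s => f s ω) :
    Measurable fun z : ℝ≥0 × Ω => Function.rightLim (fun s => f s z.2) z.1 := by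
  have h1 := measurable_uncurry_of_left_continuous hf hc
  refine measurable_of_tendsto_metrizable (f := fun (n : ℕ) (z : ℝ≥0 × Ω) =>
    f (z.1 + 1 / ((n : ℝ≥0) + 1)) z.2) (fun n => ?_) (tendsto_pi_nhds.2 fun z => ?_)
  · exact h1.comp ((measurable_fst.add_const _).prodMk measurable_snd)
  · refine ((hm z.2).tendsto_rightLim z.1).comp
      (tendsto_nhdsWithin_iff.2 ⟨?_, Eventually.of_forall fun n => ?_⟩)
    · simpa using tendsto_const_nhds.add (tendsto_one_div_add_atTop_nhds_zero_nat (𝕜 := ℝ≥0))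
    · have : (0 : ℝ≥0) < 1 / ((n : ℝ≥0) + 1) := by positivity
      exact lt_add_of_pos_right z.1 this

/-- If `d - y` exceeds `a` at some `s < t`, it does so shortly after `s` as well, because `d` is
nondecreasing and `y` right-continuous; a dense set of times below `t` therefore suffices. The
endpoint `t` is listed separately because no later time may be used. -/
lemma lt_reg_iff {d y : ℝ≥0 → ℝ} (hd : Monotone d) (hy : IsCadlagPath y) {t : ℝ≥0} {a : ℝ}
    (ha : 0 ≤ a) : a < reg d y t ↔ a < d t - y t ∨
      ∃ n : ℕ, TopologicalSpace.denseSeq ℝ≥0 n < t ∧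
        a < d (TopologicalSpace.denseSeq ℝ≥0 n) - y (TopologicalSpace.denseSeq ℝ≥0 n) := by
  constructor
  · intro h
    by_contra! hcon
    refine absurd (reg_le ha fun s hs => ?_) (not_le.2 h)
    by_contra! hs'
    rcases hs.eq_or_lt with rfl | hst
    · exact absurd hs' (not_lt.2 hcon.1)
    have h1 : ∀ᶠ u in 𝓝[>] s, y u < d s - a :=
      ((hy.right_continuous s).mono_left (nhdsWithin_mono _ Ioi_subset_Ici_self)).eventually
        (Iio_mem_nhds (by linarith))
    obtain ⟨b, hb, hb'⟩ := (mem_nhdsGT_iff_exists_Ioo_subset' hst).1 h1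
    obtain ⟨q, ⟨n, rfl⟩, hq1, hq2⟩ := (TopologicalSpace.denseRange_denseSeq ℝ≥0).exists_between
      (lt_min (show s < b from hb) hst)
    have h2 : y (TopologicalSpace.denseSeq ℝ≥0 n) < d s - a :=
      hb' ⟨hq1, hq2.trans_le (min_le_left _ _)⟩
    have h3 := hcon.2 n (hq2.trans_le (min_le_right _ _))
    have h4 := hd hq1.le
    linarith
  · rintro (h | ⟨n, hn, h⟩)
    · exact h.trans_le (le_reg hd hy le_rfl)
    · exact h.trans_le (le_reg hd hy hn.le)

lemma measurable_reg {d y : ℝ≥0 → Ω → ℝ} {t : ℝ≥0} (hd : ∀ s ≤ t, Measurable (d s))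
    (hm : ∀ ω, Monotone fun s => d s ω)
    (hy : ∀ s ≤ t, Measurable (y s)) (hy' : ∀ ω, IsCadlagPath fun s => y s ω) :
    Measurable fun ω => reg (fun s => d s ω) (fun s => y s ω) t := by
  refine measurable_of_Ioi fun a => ?_
  rcases lt_or_ge a 0 with ha | ha
  · convert! MeasurableSet.univ
    ext ω
    simpa using ha.trans_le (reg_nonneg t)
  · have h : (fun ω => reg (fun s => d s ω) (fun s => y s ω) t) ⁻¹' Ioi a
        = {ω | a < d t ω - y t ω} ∪ ⋃ n : ℕ, {ω | TopologicalSpace.denseSeq ℝ≥0 n < t ∧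
          a < d (TopologicalSpace.denseSeq ℝ≥0 n) ω - y (TopologicalSpace.denseSeq ℝ≥0 n) ω} := by
      ext ω
      rw [mem_preimage, mem_Ioi, lt_reg_iff (hm _) (hy' _) ha, mem_union, mem_iUnion]
      rfl
    rw [h]
    refine (measurableSet_lt measurable_const ((hd t le_rfl).sub (hy t le_rfl))).union ?_
    refine MeasurableSet.iUnion fun n => ?_
    by_cases hn : TopologicalSpace.denseSeq ℝ≥0 n < t
    · simp only [hn, true_and]
      exact measurableSet_lt measurable_const ((hd _ hn.le).sub (hy _ hn.le))
    · simp [hn]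

lemma measurable_uncurry_reg {d y : ℝ≥0 → Ω → ℝ} (hd : ∀ s, Measurable (d s))
    (hc : ∀ ω t, ContinuousWithinAt (fun s => d s ω) (Iic t) t)
    (hm : ∀ ω, Monotone fun s => d s ω)
    (hy : ∀ s, Measurable (y s)) (hy' : ∀ ω, IsCadlagPath fun s => y s ω) :
    Measurable fun z : ℝ≥0 × Ω => reg (fun s => d s z.2) (fun s => y s z.2) z.1 := by
  have h1 := measurable_uncurry_of_left_continuous hd hc
  have h2 := measurable_uncurry_of_right_continuous hy fun ω => (hy' ω).right_continuous
  refine measurable_of_Ioi fun a => ?_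
  rcases lt_or_ge a 0 with ha | ha
  · convert! MeasurableSet.univ
    ext z
    simpa using ha.trans_le (reg_nonneg z.1)
  · have h : (fun z : ℝ≥0 × Ω => reg (fun s => d s z.2) (fun s => y s z.2) z.1) ⁻¹' Ioi a
        = {z | a < d z.1 z.2 - y z.1 z.2} ∪ ⋃ n : ℕ, {z | TopologicalSpace.denseSeq ℝ≥0 n < z.1 ∧
          a < d (TopologicalSpace.denseSeq ℝ≥0 n) z.2
            - y (TopologicalSpace.denseSeq ℝ≥0 n) z.2} := by
      ext z
      rw [mem_preimage, mem_Ioi, lt_reg_iff (hm _) (hy' _) ha, mem_union, mem_iUnion]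
      rfl
    rw [h]
    refine (measurableSet_lt measurable_const (h1.sub h2)).union ?_
    refine MeasurableSet.iUnion fun n => ?_
    exact (measurableSet_lt measurable_const measurable_fst).inter
      (measurableSet_lt measurable_const
        (((hd _).comp measurable_snd).sub ((hy _).comp measurable_snd)))

lemma measurable_uncurry_trimmed {d y : ℝ≥0 → Ω → ℝ} (c : ℝ) (hd : ∀ s, Measurable (d s))
    (hc : ∀ ω t, ContinuousWithinAt (fun s => d s ω) (Iic t) t)
    (hm : ∀ ω, Monotone fun s => d s ω)
    (hy : ∀ s, Measurable (y s)) (hy' : ∀ ω, IsCadlagPath fun s => y s ω) :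
    Measurable fun z : ℝ≥0 × Ω => trimmed c (fun s => d s z.2) (fun s => y s z.2) z.1 := by
  have h1 := measurable_uncurry_of_left_continuous hd hc
  have h2 := measurable_uncurry_of_right_continuous hy fun ω => (hy' ω).right_continuous
  have h3 := measurable_uncurry_reg hd hc hm hy hy'
  have h4 := measurable_uncurry_rightLim hd hc hm
  have h5 : Measurable fun z : ℝ≥0 × Ω => jumpAt (fun s => d s z.2) z.1
      - excess (fun s => d s z.2) (fun s => y s z.2) z.1 :=
    (h4.sub h1).sub (measurable_const.max ((h4.sub h2).sub h3))
  exact Measurable.ite (measurableSet_lt measurable_const h5) h5 measurable_const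

lemma measurable_uncurry_jumpAt {d : ℝ≥0 → Ω → ℝ} (hd : ∀ s, Measurable (d s))
    (hp : ∀ ω, IsDividendPath fun s => d s ω) :
    Measurable fun z : ℝ≥0 × Ω => jumpAt (fun s => d s z.2) z.1 :=
  (measurable_uncurry_rightLim hd (fun ω => (hp ω).left_continuous) fun ω => (hp ω).mono).sub
    (measurable_uncurry_of_left_continuous hd fun ω => (hp ω).left_continuous)

/-- The random measure `∑_{s < t} Δd(s) δ_s`. -/
def jumpMeasure (d : ℝ≥0 → ℝ) (t : ℝ≥0) : Measure ℝ≥0 :=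
  Measure.sum fun s => (Iio t).indicator (fun s => ENNReal.ofReal (jumpAt d s)) s • Measure.dirac s

lemma lintegral_jumpMeasure (d : ℝ≥0 → ℝ) (t : ℝ≥0) {h : ℝ≥0 → ℝ≥0∞} (hh : Measurable h) :
    ∫⁻ s, h s ∂jumpMeasure d t
      = ∑' s, (Iio t).indicator (fun s => ENNReal.ofReal (jumpAt d s)) s * h s := by
  simp [jumpMeasure, lintegral_sum_measure, lintegral_dirac' _ hh]

lemma IsDividendPath.jumpMeasure_Iio {d : ℝ≥0 → ℝ} (hd : IsDividendPath d) (t r : ℝ≥0) :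
    jumpMeasure d t (Iio r) = ENNReal.ofReal (d (min r t)) := by
  rw [← lintegral_indicator_one measurableSet_Iio,
    lintegral_jumpMeasure _ _ (measurable_one.indicator measurableSet_Iio),
    ← (hd.hasSum_indicator _).tsum_eq, ENNReal.ofReal_tsum_of_nonneg
      (fun s => indicator_nonneg (fun s _ => jumpAt_nonneg hd.mono s) s)
      (hd.hasSum_indicator _).summable]
  congr 1
  ext s
  by_cases h1 : s < r <;> by_cases h2 : s < t <;> simp [h1, h2]

lemma IsDividendPath.jumpMeasure_univ {d : ℝ≥0 → ℝ} (hd : IsDividendPath d) (t : ℝ≥0) :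
    jumpMeasure d t univ = ENNReal.ofReal (d t) := by
  have h := hd.jumpMeasure_Iio t t
  rw [min_self] at h
  rw [← h, ← lintegral_indicator_one measurableSet_Iio, ← lintegral_indicator_one .univ,
    lintegral_jumpMeasure _ _ (measurable_one.indicator measurableSet_Iio),
    lintegral_jumpMeasure _ _ (measurable_one.indicator .univ)]
  congr 1
  ext s
  by_cases h2 : s < t <;> simp [h2]

/-- The sum is over uncountably many times, so measurability of the terms does not suffice. It is
the integral of `h` against the jump measure of `d`, whose masses on half-lines are values of `d`
and hence measurable in `ω`. -/
lemma measurable_tsum_indicator_jumpAt_mul {d : ℝ≥0 → Ω → ℝ} (hd : ∀ s, Measurable (d s))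
    (hp : ∀ ω, IsDividendPath fun s => d s ω) {h : ℝ≥0 → Ω → ℝ≥0∞}
    (hh : Measurable fun z : ℝ≥0 × Ω => h z.1 z.2) (t : ℝ≥0) :
    Measurable fun ω => ∑' s, (Iio t).indicator
      (fun s => ENNReal.ofReal (jumpAt (fun s => d s ω) s)) s * h s ω := by
  -- The total mass `d t ω` is not bounded in `ω`. Dividing by `w` gives a finite kernel, and the
  -- added `1` keeps `w` away from zero.
  let w : Ω → ℝ≥0∞ := fun ω => ENNReal.ofReal (d t ω) + 1
  have hw : Measurable w := (hd t).ennreal_ofReal.add_const 1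
  have hw0 : ∀ ω, w ω ≠ 0 := fun ω => by simp [w]
  have hw1 : ∀ ω, w ω ≠ ∞ := fun ω => by simp [w]
  let μ : Ω → Measure ℝ≥0 := fun ω => (w ω)⁻¹ • jumpMeasure (fun s => d s ω) t
  have hμ1 : ∀ ω, μ ω univ ≤ 1 := fun ω => by
    simp only [μ, Measure.smul_apply, (hp ω).jumpMeasure_univ, smul_eq_mul]
    rw [mul_comm, ← div_eq_mul_inv]
    exact ENNReal.div_le_of_le_mul (by simp [w])
  have hfin : ∀ ω, IsFiniteMeasure (μ ω) := fun ω => ⟨(hμ1 ω).trans_lt ENNReal.one_lt_top⟩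
  have hK : Measurable μ := by
    refine Measurable.measure_of_isPiSystem (S := range Iio)
      (by rw [← borel_eq_generateFrom_Iio]; exact BorelSpace.measurable_eq) isPiSystem_Iio ?_ ?_
    · rintro _ ⟨r, rfl⟩
      simp_rw [μ, Measure.smul_apply, (hp _).jumpMeasure_Iio]
      exact hw.inv.mul (hd _).ennreal_ofReal
    · simp_rw [μ, Measure.smul_apply, (hp _).jumpMeasure_univ]
      exact hw.inv.mul (hd _).ennreal_ofReal
  let κ : Kernel Ω ℝ≥0 := ⟨μ, hK⟩
  have : IsFiniteKernel κ := ⟨1, ENNReal.one_lt_top, hμ1⟩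
  have h1 : Measurable fun ω => ∫⁻ s, h s ω ∂κ ω :=
    Measurable.lintegral_kernel_prod_right (κ := κ) (f := fun ω s => h s ω)
      (hh.comp measurable_swap)
  convert! hw.mul h1 with ω
  change _ = w ω * ∫⁻ s, h s ω ∂((w ω)⁻¹ • jumpMeasure (fun s => d s ω) t)
  rw [lintegral_smul_measure, smul_eq_mul, ← mul_assoc, ENNReal.mul_inv_cancel (hw0 ω) (hw1 ω),
    one_mul, lintegral_jumpMeasure (h := fun s => h s ω) _ _ (hh.comp measurable_prodMk_right)]

lemma measurable_tsum_jumpAt_mul {d : ℝ≥0 → Ω → ℝ} (hd : ∀ s, Measurable (d s))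
    (hp : ∀ ω, IsDividendPath fun s => d s ω) {h : ℝ≥0 → Ω → ℝ≥0∞}
    (hh : Measurable fun z : ℝ≥0 × Ω => h z.1 z.2) :
    Measurable fun ω => ∑' s, ENNReal.ofReal (jumpAt (fun s => d s ω) s) * h s ω := by
  have h1 : ∀ n : ℕ, Measurable fun ω => ∑' s, (Iio ((n : ℝ≥0) + 1)).indicator
      (fun s => ENNReal.ofReal (jumpAt (fun s => d s ω) s)) s *
        (Ico (n : ℝ≥0) (n + 1)).indicator (fun s => h s ω) s := fun n => by
    refine measurable_tsum_indicator_jumpAt_mul hd hp ?_ _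
    exact hh.indicator (measurable_fst measurableSet_Ico)
  suffices h2 : (fun ω => ∑' s, ENNReal.ofReal (jumpAt (fun s => d s ω) s) * h s ω)
      = fun ω => ∑' n : ℕ, ∑' s, (Iio ((n : ℝ≥0) + 1)).indicator
        (fun s => ENNReal.ofReal (jumpAt (fun s => d s ω) s)) s *
          (Ico (n : ℝ≥0) (n + 1)).indicator (fun s => h s ω) s by
    rw [h2]
    exact Measurable.tsum h1
  ext ω
  rw [ENNReal.tsum_comm]
  congr 1
  ext s
  rw [tsum_eq_single ⌊s⌋₊ fun n hn => ?_]
  · have h2 : s < ⌊s⌋₊ + 1 := Nat.lt_floor_add_one s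
    have h3 : (⌊s⌋₊ : ℝ≥0) ≤ s := Nat.floor_le zero_le
    simp [h2, h3]
  · rw [indicator_of_notMem (s := Ico _ _), mul_zero]
    exact fun hs => hn ((Nat.floor_eq_iff zero_le).2 hs).symm

/-! ### Stopping at a fixed time and adaptedness of the trimmed dividends -/

lemma IsDividendPath.stopped_eq {d : ℝ≥0 → ℝ} (hd : IsDividendPath d) (t : ℝ≥0) :
    (fun s => d (min s t)) = jumpSum ((Iio t).indicator (jumpAt d)) := by
  ext s
  rw [← (hd.hasSum_indicator _).tsum_eq, jumpSum, indicator_indicator, Iio_inter_Iio]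

lemma IsDividendPath.isJumpFamily_indicator {d : ℝ≥0 → ℝ} (hd : IsDividendPath d) (t : ℝ≥0) :
    IsJumpFamily ((Iio t).indicator (jumpAt d)) :=
  hd.isJumpFamily.of_le (fun s => indicator_nonneg (fun s _ => jumpAt_nonneg hd.mono s) s)
    fun s => indicator_le_self' (fun _ _ => jumpAt_nonneg hd.mono s) s

lemma IsDividendPath.stopped {d : ℝ≥0 → ℝ} (hd : IsDividendPath d) (t : ℝ≥0) :
    IsDividendPath fun s => d (min s t) := by
  rw [hd.stopped_eq]
  exact (hd.isJumpFamily_indicator t).isDividendPath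

lemma IsDividendPath.jumpAt_stopped {d : ℝ≥0 → ℝ} (hd : IsDividendPath d) (t : ℝ≥0) :
    jumpAt (fun s => d (min s t)) = (Iio t).indicator (jumpAt d) := by
  rw [hd.stopped_eq]
  exact (hd.isJumpFamily_indicator t).jumpAt_jumpSum

lemma IsCadlagPath.stopped {y : ℝ≥0 → ℝ} (hy : IsCadlagPath y) (t : ℝ≥0) :
    IsCadlagPath fun s => y (min s t) where
  right_continuous s := by
    have h1 : ContinuousWithinAt (fun s => min s t) (Ici s) s :=
      (continuous_id.min continuous_const).continuousWithinAt
    exact ContinuousWithinAt.comp (f := fun s => min s t) (g := y) (hy.right_continuous (min s t)) h1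
      fun u (hu : s ≤ u) => show min s t ≤ min u t from min_le_min_right _ hu
  left_limits s := by
    rcases le_or_gt s t with h | h
    · obtain ⟨l, hl⟩ := hy.left_limits s
      refine ⟨l, hl.congr' ?_⟩
      filter_upwards [self_mem_nhdsWithin] with u hu
      rw [min_eq_left ((le_of_lt hu).trans h)]
    · refine ⟨y t, tendsto_const_nhds.congr' ?_⟩
      filter_upwards [mem_nhdsWithin_of_mem_nhds (Ioi_mem_nhds h)] with u hu
      rw [min_eq_right (le_of_lt hu)]

lemma trimmed_stopped {d y : ℝ≥0 → ℝ} (c : ℝ) (hd : IsDividendPath d) {s t : ℝ≥0} (hst : s < t) :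
    trimmed c (fun s => d (min s t)) (fun s => y (min s t)) s = trimmed c d y s := by
  have h1 : jumpAt (fun s => d (min s t)) s = jumpAt d s := by
    rw [hd.jumpAt_stopped, indicator_of_mem (by exact hst)]
  have h2 : Function.rightLim (fun s => d (min s t)) s = Function.rightLim d s := by
    simpa [jumpAt, min_eq_left hst.le] using h1
  have h3 : reg (fun s => d (min s t)) (fun s => y (min s t)) s = reg d y s :=
    reg_congr fun u hu => by rw [min_eq_left (hu.trans hst.le)]; exact ⟨rfl, rfl⟩
  have h4 : excess (fun s => d (min s t)) (fun s => y (min s t)) s = excess d y s := by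
    rw [excess, excess, h2, h3, min_eq_left hst.le]
  rw [trimmed, trimmed, h4, h1]

/-- The trimmed lumps have density `trimmed / jumpAt` with respect to the jump measure of `d`.
Stopping `d` and `y` at `t` leaves the lumps before `t` unchanged and uses only information up to
`t`, so the σ-algebra may be that of `t` in the filtration. -/
lemma measurable_jumpSum_trimmed {d y : ℝ≥0 → Ω → ℝ} {c : ℝ} (hc : 0 < c) {t : ℝ≥0}
    (hd : ∀ s ≤ t, Measurable (d s)) (hp : ∀ ω, IsDividendPath fun s => d s ω)
    (hy : ∀ s ≤ t, Measurable (y s)) (hy' : ∀ ω, IsCadlagPath fun s => y s ω) :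
    Measurable fun ω => jumpSum (trimmed c (fun s => d s ω) (fun s => y s ω)) t := by
  let d' : ℝ≥0 → Ω → ℝ := fun s ω => d (min s t) ω
  let y' : ℝ≥0 → Ω → ℝ := fun s ω => y (min s t) ω
  have hd' : ∀ s, Measurable (d' s) := fun s => hd _ (min_le_right _ _)
  have hp' : ∀ ω, IsDividendPath fun s => d' s ω := fun ω => (hp ω).stopped t
  have hy1 : ∀ s, Measurable (y' s) := fun s => hy _ (min_le_right _ _)
  have hy2 : ∀ ω, IsCadlagPath fun s => y' s ω := fun ω => (hy' ω).stopped t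
  have h1 := measurable_uncurry_trimmed c hd' (fun ω => (hp' ω).left_continuous)
    (fun ω => (hp' ω).mono) hy1 hy2
  have h2 := measurable_uncurry_jumpAt hd' hp'
  have h3 := measurable_tsum_indicator_jumpAt_mul hd' hp'
    (h := fun s ω => ENNReal.ofReal (trimmed c (fun s => d' s ω) (fun s => y' s ω) s)
      / ENNReal.ofReal (jumpAt (fun s => d' s ω) s)) (h1.ennreal_ofReal.div h2.ennreal_ofReal) t
  convert! h3.ennreal_toReal with ω
  have hnn : ∀ s, 0 ≤ (Iio t).indicator (trimmed c (fun s => d s ω) (fun s => y s ω)) s :=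
    fun s => indicator_nonneg (fun s _ => trimmed_nonneg hc s) s
  rw [jumpSum, ← ENNReal.toReal_ofReal (tsum_nonneg hnn), ENNReal.ofReal_tsum_of_nonneg hnn
    ((isJumpFamily_trimmed hc (hp ω) (hy' ω)).summable t)]
  congr 2
  ext s
  by_cases hs : s < t
  · have h5 : trimmed c (fun s => d' s ω) (fun s => y' s ω) s
        = trimmed c (fun s => d s ω) (fun s => y s ω) s :=
      trimmed_stopped (y := fun s => y s ω) c (hp ω) hs
    rw [indicator_of_mem (by exact hs), indicator_of_mem (by exact hs), h5]
    rcases (jumpAt_nonneg (hp' ω).mono s).eq_or_lt with h0 | h0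
    · rw [← h0]
      have h4 := trimmed_le_jumpAt (c := c) (hp' ω).mono (hy2 ω) s
      rw [← h0, h5] at h4
      simp [ENNReal.ofReal_eq_zero.2 h4]
    · rw [ENNReal.mul_div_cancel (by simpa using h0) ENNReal.ofReal_ne_top]
  · rw [indicator_of_notMem (by exact hs), indicator_of_notMem (by exact hs)]
    simp

end Measurability

/-! ### Discounting as averaging over an exponential time -/

/-- The exponential distribution with rate `q`, on the half-line. -/
def discountMeasure (q : ℝ) : Measure ℝ≥0 := (expMeasure q).map Real.toNNReal

section Discount

variable {q : ℝ}

lemma isProbabilityMeasure_discountMeasure (hq : 0 < q) :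
    IsProbabilityMeasure (discountMeasure q) :=
  have := isProbabilityMeasure_expMeasure hq
  Measure.isProbabilityMeasure_map measurable_real_toNNReal.aemeasurable

lemma discountMeasure_Iic (hq : 0 < q) (s : ℝ≥0) :
    discountMeasure q (Iic s) = ENNReal.ofReal (1 - Real.exp (-q * s)) := by
  have := isProbabilityMeasure_expMeasure hq
  have h1 : Real.toNNReal ⁻¹' Iic s = Iic (s : ℝ) := by
    ext u
    simp [Real.toNNReal_le_iff_le_coe]
  rw [discountMeasure, Measure.map_apply measurable_real_toNNReal measurableSet_Iic, h1,
    ← ofReal_cdf, cdf_expMeasure_eq hq, if_pos s.coe_nonneg, neg_mul]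

lemma discountMeasure_Ioi (hq : 0 < q) (s : ℝ≥0) :
    discountMeasure q (Ioi s) = ENNReal.ofReal (Real.exp (-q * s)) := by
  have := isProbabilityMeasure_discountMeasure hq
  have h : Real.exp (-q * s) ≤ 1 :=
    Real.exp_le_one_iff.2 (by have := mul_nonneg hq.le s.2; simpa using this)
  rw [← compl_Iic, prob_compl_eq_one_sub measurableSet_Iic, discountMeasure_Iic hq,
    ← ENNReal.ofReal_one, ← ENNReal.ofReal_sub _ (sub_nonneg.2 h), sub_sub_cancel]

lemma discountMeasure_singleton (hq : 0 < q) (s : ℝ≥0) : discountMeasure q {s} = 0 := by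
  rcases eq_or_lt_of_le (zero_le (a := s)) with rfl | hs
  · refine measure_mono_null (t := Iic 0) (by simp) ?_
    simp [discountMeasure_Iic hq]
  · rw [discountMeasure, Measure.map_apply measurable_real_toNNReal (measurableSet_singleton s)]
    have h1 : Real.toNNReal ⁻¹' {s} ⊆ {(s : ℝ)} := fun u hu => by
      have h2 : Real.toNNReal u = s := hu
      rw [mem_singleton_iff, ← h2, Real.coe_toNNReal]
      by_contra! hneg
      rw [Real.toNNReal_of_nonpos hneg.le] at h2
      exact hs.ne h2
    refine measure_mono_null h1 ?_
    exact withDensity_absolutelyContinuous _ _ Real.volume_singleton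

/-- The law has no atoms, so the same discount factor serves dividends, which count jumps at `s <
t`, and injections, which count mass at `s ≤ t`. -/
lemma discountMeasure_Ici (hq : 0 < q) (s : ℝ≥0) :
    discountMeasure q (Ici s) = ENNReal.ofReal (Real.exp (-q * s)) := by
  refine le_antisymm ?_ ?_
  · rw [← Ioi_union_left]
    refine (measure_union_le _ _).trans ?_
    rw [discountMeasure_singleton hq, add_zero, discountMeasure_Ioi hq]
  · rw [← discountMeasure_Ioi hq]
    exact measure_mono Ioi_subset_Ici_self

lemma discountMeasure_Ioc_pos (hq : 0 < q) {a b : ℝ≥0} (hab : a < b) :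
    0 < discountMeasure q (Ioc a b) := by
  have := isProbabilityMeasure_discountMeasure hq
  rw [← Iic_sdiff_Iic, measure_sdiff (Iic_subset_Iic.2 hab.le) measurableSet_Iic.nullMeasurableSet
    (measure_ne_top _ _), discountMeasure_Iic hq, discountMeasure_Iic hq, tsub_pos_iff_lt]
  have h1 : Real.exp (-q * b) < Real.exp (-q * a) := Real.exp_lt_exp.2 (by
    have := mul_lt_mul_of_pos_left (NNReal.coe_lt_coe.2 hab) hq
    linarith)
  have h2 : Real.exp (-q * b) < 1 := Real.exp_zero ▸ Real.exp_lt_exp.2 (by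
    have := mul_pos hq (NNReal.coe_pos.2 (zero_le.trans_lt hab))
    linarith)
  exact (ENNReal.ofReal_lt_ofReal_iff (by linarith)).2 (by linarith)

/-- The exponential law charges every nondegenerate interval, so equality holds at times arbitrarily
close to `t` from the right. -/
lemma eq_of_ae_eq_discountMeasure (hq : 0 < q) {f g : ℝ≥0 → ℝ}
    (hf : ∀ t, ContinuousWithinAt f (Ici t) t) (hg : ∀ t, ContinuousWithinAt g (Ici t) t)
    (h : ∀ᵐ t ∂discountMeasure q, f t = g t) : f = g := by
  ext t
  have h1 : Tendsto (fun s => f s - g s) (𝓝[>] t) (𝓝 (f t - g t)) :=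
    ((hf t).sub (hg t)).mono_left (nhdsWithin_mono _ Ioi_subset_Ici_self)
  have h2 : ∃ᶠ s in 𝓝[>] t, f s - g s = 0 := by
    rw [Filter.Frequently, (nhdsGT_basis t).eventually_iff]
    rintro ⟨b, hb, hb'⟩
    obtain ⟨b', hb1, hb2⟩ := exists_between hb
    refine (discountMeasure_Ioc_pos hq hb1).ne' (measure_mono_null (fun s hs => ?_) h)
    have := hb' ⟨hs.1, hs.2.trans_lt hb2⟩
    exact fun h => this (sub_eq_zero.2 h)
  refine sub_eq_zero.1 ?_
  by_contra hne
  exact h2 (h1.eventually_ne hne)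

/-- Tonelli applied to the indicator of `t ≤ s`. The left limit at the bottom point is `f 0`, so the
Stieltjes measure has no mass at time `0`. -/
lemma lintegral_exp_stieltjes (hq : 0 < q) (f : StieltjesFunction ℝ≥0) (hf : f 0 = 0) :
    ∫⁻ t : ℝ≥0, ENNReal.ofReal (Real.exp (-q * t)) ∂f.measure
      = ∫⁻ t, ENNReal.ofReal (f t) ∂discountMeasure q := by
  have := isProbabilityMeasure_discountMeasure hq
  have h1 : ∀ t : ℝ≥0, ENNReal.ofReal (Real.exp (-q * t))
      = ∫⁻ s, (Ici t).indicator 1 s ∂discountMeasure q := fun t => by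
    rw [lintegral_indicator_one measurableSet_Ici, discountMeasure_Ici hq]
  have h2 : ∀ s : ℝ≥0, ENNReal.ofReal (f s) = ∫⁻ t, (Iic s).indicator 1 t ∂f.measure := fun s => by
    rw [lintegral_indicator_one measurableSet_Iic, ← Icc_bot, f.measure_Icc,
      leftLim_eq_of_isBot isBot_bot]
    change _ = ENNReal.ofReal (f s - f 0)
    rw [hf, sub_zero]
  simp_rw [h1, h2]
  rw [lintegral_lintegral_swap]
  · rfl
  · refine Measurable.aemeasurable ?_
    exact measurable_one.indicator (s := {z : ℝ≥0 × ℝ≥0 | z.1 ≤ z.2})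
      (measurableSet_le measurable_fst measurable_snd)

lemma IsJumpFamily.countable_support {p : ℝ≥0 → ℝ} (hp : IsJumpFamily p) :
    (Function.support p).Countable := by
  refine (countable_iUnion fun n : ℕ => (hp.summable (n + 1)).countable_support).mono fun s hs => ?_
  refine mem_iUnion.2 ⟨⌊s⌋₊, ?_⟩
  rw [Function.mem_support, indicator_of_mem (by exact Nat.lt_floor_add_one s)]
  exact hs

/-- Tonelli again. The sum is first restricted to the countable support of `p`, since exchanging sum
and integral needs a countable index. -/
lemma IsJumpFamily.tsum_exp_mul (hq : 0 < q) {p : ℝ≥0 → ℝ} (hp : IsJumpFamily p) :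
    ∑' s : ℝ≥0, ENNReal.ofReal (Real.exp (-q * s) * p s)
      = ∫⁻ t, ENNReal.ofReal (jumpSum p t) ∂discountMeasure q := by
  have hc : Countable (Function.support p) := hp.countable_support.to_subtype
  have h1 : ∀ s : ℝ≥0, ENNReal.ofReal (Real.exp (-q * s) * p s)
      = ∫⁻ t, (Ioi s).indicator (fun _ => ENNReal.ofReal (p s)) t ∂discountMeasure q := fun s => by
    rw [lintegral_indicator_const measurableSet_Ioi, discountMeasure_Ioi hq,
      ENNReal.ofReal_mul (Real.exp_nonneg _), mul_comm]
  have h2 : ∀ t, ENNReal.ofReal (jumpSum p t)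
      = ∑' s, (Ioi s).indicator (fun _ => ENNReal.ofReal (p s)) t := fun t => by
    rw [jumpSum, ENNReal.ofReal_tsum_of_nonneg
      (fun s => indicator_nonneg (fun s _ => hp.nonneg s) s) (hp.summable t)]
    congr 1
    ext s
    by_cases h : s < t <;> simp [h]
  have h3 : ∀ t, (∑' s, (Ioi s).indicator (fun _ => ENNReal.ofReal (p s)) t)
      = ∑' s : Function.support p, (Ioi s.1).indicator (fun _ => ENNReal.ofReal (p s.1)) t :=
    fun t => (tsum_subtype_eq_of_support_subset fun s hs => by
      rw [Function.mem_support] at hs ⊢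
      contrapose! hs
      simp [hs]).symm
  have h4 : ∑' s : ℝ≥0, ENNReal.ofReal (Real.exp (-q * s) * p s)
      = ∑' s : Function.support p, ENNReal.ofReal (Real.exp (-q * s.1) * p s.1) :=
    (tsum_subtype_eq_of_support_subset fun s hs => by
      rw [Function.mem_support] at hs ⊢
      contrapose! hs
      simp [hs]).symm
  simp_rw [h2, h3]
  rw [lintegral_tsum fun s => (measurable_const.indicator measurableSet_Ioi).aemeasurable, h4]
  congr 1
  ext s
  exact h1 s

end Discount

/-! ### Processes with independent increments -/

lemma measurableSet_first_exceedance {Ω : Type*} {m : MeasurableSpace Ω} {X : ℝ≥0 → Ω → ℝ}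
    {s u : ℝ≥0} (I : Finset ℝ≥0) (hX : ∀ v ≤ u, Measurable (X v)) (hsu : s ≤ u) (c : ℝ) :
    MeasurableSet {ω | c < |X u ω - X s ω| ∧ ∀ v ∈ I, v < u → |X v ω - X s ω| ≤ c} := by
  have hm : ∀ v ≤ u, Measurable fun ω => |X v ω - X s ω| := fun v hv =>
    ((hX v hv).sub (hX s hsu)).abs
  have h : {ω | c < |X u ω - X s ω| ∧ ∀ v ∈ I, v < u → |X v ω - X s ω| ≤ c}
      = {ω | c < |X u ω - X s ω|} ∩ ⋂ v ∈ I, ⋂ _ : v < u, {ω | |X v ω - X s ω| ≤ c} := by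
    ext ω
    simp
  rw [h]
  refine (measurableSet_lt measurable_const (hm u le_rfl)).inter ?_
  exact I.measurableSet_biInter fun v _ => MeasurableSet.iInter fun hv =>
    measurableSet_le (hm v hv.le) measurable_const

section Increments

variable {Ω : Type*} [mΩ : MeasurableSpace Ω] {P : Measure Ω} [IsProbabilityMeasure P]
  {X : ℝ≥0 → Ω → ℝ} {x : ℝ}

lemma exists_monotone_enumeration (I : Finset ℝ≥0) : ∀ s : ℝ≥0, (∀ u ∈ I, u ≤ s) →
    ∃ (τ : ℕ → ℝ≥0) (N : ℕ), Monotone τ ∧ τ 0 = 0 ∧ (∀ n, N ≤ n → τ n = s) ∧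
      ∀ u ∈ I, ∃ n ≤ N, τ n = u := by
  have key : ∀ (τ : ℕ → ℝ≥0) (N : ℕ) (a s : ℝ≥0), a ≤ s → Monotone τ → (∀ n, N ≤ n → τ n = a) →
      Monotone fun n => if n ≤ N then τ n else s := by
    intro τ N a s has hτ hN
    refine monotone_nat_of_le_succ fun n => ?_
    split_ifs with h1 h2 h2
    · exact hτ n.le_succ
    · exact ((hτ h1).trans (hN N le_rfl).le).trans has
    · omega
    · exact le_rfl
  induction I using Finset.induction_on_max with
  | empty =>
    intro s _
    refine ⟨fun n => if n ≤ 0 then (fun _ => 0) n else s, 1,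
      key (fun _ => 0) 0 0 s zero_le monotone_const (fun _ _ => rfl), by simp, fun n hn => ?_,
      by simp⟩
    simp only
    rw [if_neg (by omega)]
  | insert a I ha ih =>
    intro s hs
    obtain ⟨τ, N, hτ, h0, hN, hI⟩ := ih a fun u hu => (ha u hu).le
    refine ⟨fun n => if n ≤ N then τ n else s, N + 1,
      key τ N a s (hs a (Finset.mem_insert_self _ _)) hτ hN, by simpa using h0, fun n hn => ?_, ?_⟩
    · simp only
      rw [if_neg (by omega)]
    · intro u hu
      rcases Finset.mem_insert.1 hu with rfl | hu
      · exact ⟨N, N.le_succ, by simpa using hN N le_rfl⟩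
      · obtain ⟨n, hn, rfl⟩ := hI u hu
        exact ⟨n, hn.trans N.le_succ, by simp [hn]⟩

/-- It is enough to treat finitely many times up to `s`. As the starting point is deterministic, the
values there are functions of successive increments, which are jointly independent of the increment
from `s` to `t`. -/
lemma indep_naturalFiltration (hX : ∀ t, Measurable (X t)) (h0 : ∀ ω, X 0 ω = x)
    (hI : HasIndepIncrements X P) {s t : ℝ≥0} (hst : s ≤ t) :
    Indep (naturalFiltration X hX s)
      (MeasurableSpace.comap (fun ω => X t ω - X s ω) inferInstance) P := by
  rw [naturalFiltration, Filtration.natural_eq_comap]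
  refine IndepFun.process_indepFun (X := fun j : Iic s => X j) (fun j => hX j)
    ((hX t).sub (hX s)) fun I => ?_
  obtain ⟨τ, N, hτ, hτ0, hN, hmem⟩ := exists_monotone_enumeration (I.image Subtype.val) s
    (by simp only [Finset.mem_image]; rintro _ ⟨u, _, rfl⟩; exact u.2)
  -- The times stay at or below `s` through index `N`, where the value is `s`, and then jump to `t`:
  -- increment number `N` is `X t - X s`.
  let σ : ℕ → ℝ≥0 := fun n => if n ≤ N then τ n else t
  have hσ : Monotone σ := by
    refine monotone_nat_of_le_succ fun n => ?_
    simp only [σ]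
    split_ifs with h1 h2 h2
    · exact hτ n.le_succ
    · exact ((hτ h1).trans (hN N le_rfl).le).trans hst
    · omega
    · exact le_rfl
  have h1 := hI.nat hσ
  have h2 := h1.indepFun_finset (Finset.range N) {N} (by simp)
    (fun i => (hX _).sub (hX _))
  have hidx : ∀ i : I, ∃ n ≤ N, τ n = i.1.1 := fun i =>
    hmem _ (Finset.mem_image_of_mem _ i.2)
  choose idx hidx1 hidx2 using hidx
  have hsum : ∀ ω n, n ≤ N → X (τ n) ω = x + ∑ k ∈ Finset.range n, (X (σ (k + 1)) ω - X (σ k) ω) := by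
    intro ω n hn
    rw [Finset.sum_range_sub (fun k => X (σ k) ω)]
    simp [σ, hn, hτ0, h0]
  let F : (Finset.range N → ℝ) → (I → ℝ) := fun z i =>
    x + ∑ k : Finset.range N, if k.1 < idx i then z k else 0
  let G : (({N} : Finset ℕ) → ℝ) → ℝ := fun z => z ⟨N, by simp⟩
  have hF : Measurable F := by
    refine measurable_pi_lambda _ fun i => measurable_const.add ?_
    refine Finset.measurable_sum _ fun k _ => ?_
    split_ifs
    · exact measurable_pi_apply k
    · exact measurable_const
  have h3 := h2.comp hF (measurable_pi_apply _ : Measurable G)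
  convert! h3 using 1
  · ext ω i
    simp only [Function.comp, F]
    rw [Finset.sum_coe_sort (Finset.range N)
      (fun k => if k < idx i then X (σ (k + 1)) ω - X (σ k) ω else 0), ← Finset.sum_filter,
      ← hidx2 i, hsum ω _ (hidx1 i)]
    congr 2
    ext k
    have := hidx1 i
    simp only [Finset.mem_filter, Finset.mem_range]
    omega
  · ext ω
    simp [σ, hN N le_rfl]

lemma measure_inter_increment (hX : ∀ t, Measurable (X t)) (h0 : ∀ ω, X 0 ω = x)
    (hI : HasIndepIncrements X P) {s t : ℝ≥0} (hst : s ≤ t) {A : Set Ω}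
    (hA : MeasurableSet[naturalFiltration X hX s] A) {B : Set ℝ} (hB : MeasurableSet B) :
    P (A ∩ {ω | X t ω - X s ω ∈ B}) = P A * P {ω | X t ω - X s ω ∈ B} :=
  (Indep_iff _ _ P).1 (indep_naturalFiltration hX h0 hI hst) A _ hA ⟨B, hB, rfl⟩

lemma measurable_naturalFiltration (hX : ∀ t, Measurable (X t)) {s t : ℝ≥0} (hst : s ≤ t) :
    Measurable[naturalFiltration X hX t] (X s) :=
  Measurable.mono (comap_measurable (X s))
    (le_iSup₂_of_le (f := fun j (_ : j ≤ t) => MeasurableSpace.comap (X j) _) s hst le_rfl) le_rfl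

/-- Ottaviani's inequality over finitely many times. -/
lemma measure_exists_mem_le (hX : ∀ t, Measurable (X t)) (h0 : ∀ ω, X 0 ω = x)
    (hI : HasIndepIncrements X P) {s t : ℝ≥0} (I : Finset ℝ≥0)
    (hst : ∀ u ∈ I, s ≤ u ∧ u ≤ t) {a b : ℝ}
    (hb : ∀ u ∈ I, 2⁻¹ ≤ P {ω | |X t ω - X u ω| ≤ b}) :
    P {ω | ∃ u ∈ I, a + b < |X u ω - X s ω|} ≤ 2 * P {ω | a < |X t ω - X s ω|} := by
  -- `A u`: the level `a + b` is first exceeded at `u`, an event of the past. `B u`: the remaining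
  -- increment is at most `b`, an independent event. On both, the displacement at `t` still exceeds
  -- `a`, and `P (B u) ≥ 1/2` costs the factor 2.
  let A : ℝ≥0 → Set Ω := fun u =>
    {ω | a + b < |X u ω - X s ω| ∧ ∀ v ∈ I, v < u → |X v ω - X s ω| ≤ a + b}
  let B : ℝ≥0 → Set Ω := fun u => {ω | X t ω - X u ω ∈ Icc (-b) b}
  have hB : ∀ u, B u = {ω | |X t ω - X u ω| ≤ b} := fun u => by
    ext ω; exact abs_le.symm
  have hA : ∀ u ∈ I, MeasurableSet[naturalFiltration X hX u] (A u) := by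
    exact fun u hu => measurableSet_first_exceedance I
      (fun v hv => measurable_naturalFiltration hX hv) (hst u hu).1 (a + b)
  have hA' : ∀ u ∈ I, MeasurableSet (A u) := fun u hu => (naturalFiltration X hX).le u _ (hA u hu)
  have hBm : ∀ u, MeasurableSet (B u) := fun u => ((hX t).sub (hX u)) measurableSet_Icc
  have hdisj : (I : Set ℝ≥0).PairwiseDisjoint fun u => A u ∩ B u := by
    intro u hu v hv huv
    refine Set.disjoint_left.2 fun ω h1 h2 => ?_
    rcases lt_or_gt_of_ne huv with h | h
    · exact absurd (h2.1.2 u hu h) (not_le.2 h1.1.1)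
    · exact absurd (h1.1.2 v hv h) (not_le.2 h2.1.1)
  have h1 : {ω | ∃ u ∈ I, a + b < |X u ω - X s ω|} ⊆ ⋃ u ∈ I, A u := by
    rintro ω ⟨u, hu, hω⟩
    let J := I.filter fun u => a + b < |X u ω - X s ω|
    have hJ : J.Nonempty := ⟨u, Finset.mem_filter.2 ⟨hu, hω⟩⟩
    have hmin := Finset.mem_filter.1 (J.min'_mem hJ)
    refine mem_iUnion₂.2 ⟨J.min' hJ, hmin.1, hmin.2, fun v hv hlt => ?_⟩
    by_contra! hcon
    exact absurd (J.min'_le v (Finset.mem_filter.2 ⟨hv, hcon⟩)) (not_le.2 hlt)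
  have h2 : ⋃ u ∈ I, (A u ∩ B u) ⊆ {ω | a < |X t ω - X s ω|} := by
    intro ω hω
    obtain ⟨u, hu, hω1, hω2⟩ := mem_iUnion₂.1 hω
    rw [hB] at hω2
    have h3 := hω1.1
    have h4 : |X t ω - X u ω| ≤ b := hω2
    have h5 := abs_sub_abs_le_abs_sub (X u ω - X s ω) (X u ω - X t ω)
    rw [abs_sub_comm (X u ω) (X t ω), sub_sub_sub_cancel_left] at h5
    change a < _
    linarith
  calc P {ω | ∃ u ∈ I, a + b < |X u ω - X s ω|} ≤ ∑ u ∈ I, P (A u) :=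
        (measure_mono h1).trans (measure_biUnion_finset_le _ _)
    _ ≤ ∑ u ∈ I, 2 * P (A u ∩ B u) := by
        refine Finset.sum_le_sum fun u hu => ?_
        rw [measure_inter_increment hX h0 hI (hst u hu).2 (hA u hu) measurableSet_Icc]
        have h3 := hb u hu
        rw [← hB] at h3
        calc P (A u) = 2 * (P (A u) * 2⁻¹) := by
              rw [mul_comm (P (A u)), ← mul_assoc, ENNReal.mul_inv_cancel (by simp) (by simp),
                one_mul]
          _ ≤ _ := by gcongr
    _ = 2 * P (⋃ u ∈ I, (A u ∩ B u)) := by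
        rw [← Finset.mul_sum, measure_biUnion_finset hdisj fun u hu => (hA' u hu).inter (hBm u)]
    _ ≤ _ := by gcongr

end Increments

/-! ### Integrability of the running maximum -/

/-- A sequence of times in `[s, t]`, dense from the right and containing `t`. -/
def gridTime (s t : ℝ≥0) (k : ℕ) : ℝ≥0 := min (s + TopologicalSpace.denseSeq ℝ≥0 k) t

/-- The supremum of `|y u - y s|` over `u ∈ [s, t]`. -/
def oscillation (y : ℝ≥0 → ℝ) (s t : ℝ≥0) : ℝ := ⨆ k, |y (gridTime s t k) - y s|

section Oscillation

variable {y : ℝ≥0 → ℝ} {s t : ℝ≥0}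

lemma le_gridTime (hst : s ≤ t) (k : ℕ) : s ≤ gridTime s t k :=
  le_min (le_add_of_nonneg_right zero_le) hst

lemma gridTime_le (k : ℕ) : gridTime s t k ≤ t := min_le_right _ _

lemma IsCadlagPath.bddAbove_grid (hy : IsCadlagPath y) (s t : ℝ≥0) :
    BddAbove (range fun k => |y (gridTime s t k) - y s|) := by
  obtain ⟨b, hb⟩ := hy.exists_abs_le t
  refine ⟨b + |y s|, ?_⟩
  rintro _ ⟨k, rfl⟩
  exact (abs_sub _ _).trans (add_le_add_left (hb _ (gridTime_le k)) _)

lemma oscillation_nonneg : 0 ≤ oscillation y s t := Real.iSup_nonneg fun _ => abs_nonneg _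

lemma IsCadlagPath.abs_sub_le_oscillation (hy : IsCadlagPath y) {v : ℝ≥0} (hsv : s ≤ v)
    (hvt : v ≤ t) : |y v - y s| ≤ oscillation y s t := by
  have hbdd := hy.bddAbove_grid s t
  by_contra! hcon
  rcases hvt.eq_or_lt with rfl | hvt
  · obtain ⟨_, ⟨k, rfl⟩, hk, -⟩ := (TopologicalSpace.denseRange_denseSeq ℝ≥0).exists_between
      (lt_add_one (v - s))
    have h1 : gridTime s v k = v := min_eq_right (by
      rw [add_comm]; exact tsub_le_iff_right.1 hk.le)
    have h2 : |y (gridTime s v k) - y s| ≤ oscillation y s v := le_ciSup hbdd k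
    rw [h1] at h2
    exact absurd hcon (not_lt.2 h2)
  · have h1 : Tendsto (fun u => |y u - y s|) (𝓝[>] v) (𝓝 |y v - y s|) :=
      (((hy.right_continuous v).mono_left (nhdsWithin_mono _ Ioi_subset_Ici_self)).sub_const _).abs
    obtain ⟨b, hb, hb'⟩ := (mem_nhdsGT_iff_exists_Ioo_subset' hvt).1
      (h1.eventually (Ioi_mem_nhds hcon))
    have hlt : v < min b t := lt_min hb hvt
    have h3 : v - s < min b t - s :=
      tsub_lt_tsub_right_of_le hsv hlt
    obtain ⟨_, ⟨k, rfl⟩, hk1, hk2⟩ :=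
      (TopologicalSpace.denseRange_denseSeq ℝ≥0).exists_between h3
    have h4 : v < s + TopologicalSpace.denseSeq ℝ≥0 k := by
      rw [add_comm]; exact (tsub_lt_iff_right hsv).1 hk1
    have h5 : s + TopologicalSpace.denseSeq ℝ≥0 k < min b t := by
      rw [add_comm]; exact lt_tsub_iff_right.1 hk2
    have h6 : gridTime s t k = s + TopologicalSpace.denseSeq ℝ≥0 k :=
      min_eq_left (h5.le.trans (min_le_right _ _))
    have h7 : oscillation y s t < |y (gridTime s t k) - y s| := by
      rw [h6]
      exact hb' ⟨h4, h5.trans_le (min_le_left _ _)⟩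
    exact absurd (le_ciSup hbdd k) (not_le.2 h7)

lemma IsCadlagPath.abs_le_sum_oscillation (hy : IsCadlagPath y) (s : ℝ≥0) :
    |y s| ≤ |y 0| + ∑ k ∈ Finset.range (⌊s⌋₊ + 1), oscillation y k (k + 1) := by
  have h1 : ∀ n : ℕ, |y n| ≤ |y 0| + ∑ k ∈ Finset.range n, oscillation y k (k + 1) := by
    intro n
    induction n with
    | zero => simp
    | succ n ih =>
      rw [Finset.sum_range_succ]
      have h2 := hy.abs_sub_le_oscillation (s := n) (t := n + 1) (v := n + 1)
        (le_add_of_nonneg_right zero_le) le_rfl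
      have h3 := abs_sub_abs_le_abs_sub (y (n + 1)) (y n)
      push_cast
      linarith
  have h2 := hy.abs_sub_le_oscillation (s := ⌊s⌋₊) (t := ⌊s⌋₊ + 1) (v := s)
    (Nat.floor_le zero_le) (Nat.lt_floor_add_one s).le
  have h3 := abs_sub_abs_le_abs_sub (y s) (y ⌊s⌋₊)
  have h4 := h1 ⌊s⌋₊
  rw [Finset.sum_range_succ]
  linarith

end Oscillation

namespace IsSpectrallyNegativeLevy

variable {Ω : Type*} [mΩ : MeasurableSpace Ω] {P : Measure Ω} {X : ℝ≥0 → Ω → ℝ} {x : ℝ}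

lemma isCadlagPath (hX : IsSpectrallyNegativeLevy X P x) (ω : Ω) : IsCadlagPath fun s => X s ω :=
  ⟨hX.right_continuous ω, hX.left_limits ω⟩

lemma measure_increment (hX : IsSpectrallyNegativeLevy X P x) {s t : ℝ≥0} (hst : s ≤ t)
    {B : Set ℝ} (hB : MeasurableSet B) :
    P {ω | X t ω - X s ω ∈ B} = P {ω | X (t - s) ω - x ∈ B} := by
  have h := hX.stationary_increments s (t - s)
  rw [add_tsub_cancel_of_le hst] at h
  have h1 := DFunLike.congr_fun h B
  rw [Measure.map_apply (f := fun ω => X t ω - X s ω)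
      ((hX.measurable t).sub (hX.measurable s)) hB,
    Measure.map_apply (f := fun ω => X (t - s) ω - X 0 ω)
      ((hX.measurable _).sub (hX.measurable 0)) hB] at h1
  simpa only [hX.start] using! h1

lemma measurable_oscillation (hX : IsSpectrallyNegativeLevy X P x) (s t : ℝ≥0) :
    Measurable fun ω => oscillation (fun u => X u ω) s t :=
  Measurable.iSup fun _ => ((hX.measurable _).sub (hX.measurable _)).abs

variable [IsProbabilityMeasure P]

/-- Paths are bounded on `[0, 1]`, so some level bounds them there with probability above one half.
Stationarity carries this level to every interval of length at most 1. -/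
lemma exists_forall_half_le (hX : IsSpectrallyNegativeLevy X P x) :
    ∃ b : ℝ, 0 ≤ b ∧ ∀ s t : ℝ≥0, s ≤ t → t ≤ s + 1 → 2⁻¹ ≤ P {ω | |X t ω - X s ω| ≤ b} := by
  let A : ℕ → Set Ω := fun n => {ω | ∀ h ≤ (1 : ℝ≥0), |X h ω - x| ≤ n}
  have hA : Monotone A := fun m n hmn ω hω h hh => (hω h hh).trans (Nat.cast_le.2 hmn)
  have hU : ⋃ n, A n = univ := by
    refine eq_univ_of_forall fun ω => ?_
    obtain ⟨b, hb⟩ := (hX.isCadlagPath ω).exists_abs_le 1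
    obtain ⟨n, hn⟩ := exists_nat_ge (b + |x|)
    refine mem_iUnion.2 ⟨n, fun h hh => ?_⟩
    have h1 := abs_sub (X h ω) x
    have h2 := hb h hh
    linarith
  have h1 := tendsto_measure_iUnion_atTop (μ := P) hA
  rw [hU, measure_univ] at h1
  obtain ⟨n, hn⟩ := (h1.eventually (Ioi_mem_nhds (show (2⁻¹ : ℝ≥0∞) < 1 by simp))).exists
  refine ⟨n, n.cast_nonneg, fun s t hst hts => (le_of_lt hn).trans ?_⟩
  have h2 : {ω | |X t ω - X s ω| ≤ n} = {ω | X t ω - X s ω ∈ Icc (-(n : ℝ)) n} := by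
    ext ω
    exact abs_le (a := X t ω - X s ω)
  rw [h2, hX.measure_increment hst measurableSet_Icc]
  exact measure_mono fun ω hω => abs_le.1 (hω (t - s) (tsub_le_iff_left.2 hts))

lemma measure_lt_oscillation_le (hX : IsSpectrallyNegativeLevy X P x) {s t : ℝ≥0} (hst : s ≤ t)
    {a b : ℝ} (hb : ∀ u, s ≤ u → u ≤ t → 2⁻¹ ≤ P {ω | |X t ω - X u ω| ≤ b}) :
    P {ω | a + b < oscillation (fun u => X u ω) s t} ≤ 2 * P {ω | a < |X t ω - X s ω|} := by
  classical
  let I : ℕ → Finset ℝ≥0 := fun n => (Finset.range n).image (gridTime s t)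
  let A : ℕ → Set Ω := fun n => {ω | ∃ u ∈ I n, a + b < |X u ω - X s ω|}
  have hA : Monotone A := fun m n hmn ω ⟨u, hu, hω⟩ =>
    ⟨u, Finset.image_subset_image (Finset.range_subset_range.2 hmn) hu, hω⟩
  have hU : {ω | a + b < oscillation (fun u => X u ω) s t} ⊆ ⋃ n, A n := by
    intro ω hω
    obtain ⟨k, hk⟩ := exists_lt_of_lt_ciSup (show a + b < ⨆ k, _ from hω)
    exact mem_iUnion.2 ⟨k + 1, _, Finset.mem_image_of_mem _ (Finset.self_mem_range_succ k), hk⟩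
  refine (measure_mono hU).trans ?_
  refine le_of_tendsto' (tendsto_measure_iUnion_atTop hA) fun n => ?_
  have hI : ∀ u ∈ I n, s ≤ u ∧ u ≤ t := by
    intro u hu
    obtain ⟨k, -, rfl⟩ := Finset.mem_image.1 hu
    exact ⟨le_gridTime hst k, gridTime_le k⟩
  exact measure_exists_mem_le hX.measurable hX.start hX.indep_increments (I n) hI
    fun u hu => hb u (hI u hu).1 (hI u hu).2

/-- The maximal inequality is integrated over the level `a` by the layer-cake formula. Stationarity
reduces the increment over `[n, n+1]` to `X 1 - x`, so the bound does not depend on `n`. -/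
lemma exists_lintegral_oscillation_le (hX : IsSpectrallyNegativeLevy X P x)
    (hmean : Integrable (X 1) P) : ∃ M : ℝ≥0∞, M ≠ ∞ ∧ ∀ n : ℕ,
      ∫⁻ ω, ENNReal.ofReal (oscillation (fun u => X u ω) n (n + 1)) ∂P ≤ M := by
  obtain ⟨b, hb0, hb⟩ := hX.exists_forall_half_le
  have hint : Integrable (fun ω => |X 1 ω - x|) P := (hmean.sub (integrable_const x)).abs
  refine ⟨ENNReal.ofReal b + 2 * ∫⁻ ω, ENNReal.ofReal |X 1 ω - x| ∂P,
    ENNReal.add_ne_top.2 ⟨ENNReal.ofReal_ne_top, ENNReal.mul_ne_top (by simp)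
      hint.lintegral_lt_top.ne⟩, fun n => ?_⟩
  have hn : (n : ℝ≥0) ≤ n + 1 := le_add_of_nonneg_right zero_le
  have hm := hX.measurable_oscillation n (n + 1)
  have h1 : ∫⁻ ω, ENNReal.ofReal (oscillation (fun u => X u ω) n (n + 1)) ∂P
      ≤ ∫⁻ ω, (ENNReal.ofReal b
        + ENNReal.ofReal (max (oscillation (fun u => X u ω) n (n + 1) - b) 0)) ∂P := by
    refine lintegral_mono fun ω => ?_
    rw [← ENNReal.ofReal_add hb0 (le_max_right _ _)]
    refine ENNReal.ofReal_le_ofReal ?_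
    linarith [le_max_left (oscillation (fun u => X u ω) n (n + 1) - b) 0]
  refine h1.trans ?_
  rw [lintegral_add_left measurable_const, lintegral_const, measure_univ, mul_one]
  gcongr
  rw [lintegral_eq_lintegral_meas_lt (f := fun ω =>
        max (oscillation (fun u => X u ω) n (n + 1) - b) 0) P (ae_of_all _ fun ω => le_max_right _ _)
      ((hm.sub_const b).max measurable_const).aemeasurable,
    lintegral_eq_lintegral_meas_lt P (ae_of_all _ fun ω => abs_nonneg _)
      ((hX.measurable 1).sub_const x).abs.aemeasurable,
    ← lintegral_const_mul' _ _ (by simp)]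
  refine setLIntegral_mono' measurableSet_Ioi fun a ha => ?_
  have h2 : {ω | a < max (oscillation (fun u => X u ω) n (n + 1) - b) 0}
      ⊆ {ω | a + b < oscillation (fun u => X u ω) n (n + 1)} := by
    intro ω hω
    rcases lt_max_iff.1 (show a < max _ _ from hω) with h | h
    · exact lt_sub_iff_add_lt.1 h
    · exact absurd h (not_lt.2 (le_of_lt ha))
  refine (measure_mono h2).trans ((hX.measure_lt_oscillation_le hn fun u hu1 hu2 =>
    hb u _ hu2 (by gcongr)).trans ?_)
  have h3 : {ω | a < |X (n + 1) ω - X n ω|} = {ω | X (n + 1) ω - X n ω ∈ {z | a < |z|}} := rfl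
  rw [h3, hX.measure_increment hn (measurableSet_lt measurable_const measurable_abs),
    add_tsub_cancel_left]
  rfl

/-- A bound for the discounted running maximum of `|X|`. -/
lemma exists_discounted_bound (hX : IsSpectrallyNegativeLevy X P x)
    (hmean : Integrable (X 1) P) {q : ℝ} (hq : 0 < q) : ∃ g : ℝ≥0 → Ω → ℝ≥0∞,
      (∀ ω s t, s ≤ t → ENNReal.ofReal |X s ω| ≤ g t ω) ∧
      (∀ ω, Measurable fun t => g t ω) ∧
      (Measurable fun ω => ∫⁻ t, g t ω ∂discountMeasure q) ∧
      ∫⁻ ω, ∫⁻ t, g t ω ∂discountMeasure q ∂P ≠ ∞ := by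
  have := isProbabilityMeasure_discountMeasure hq
  obtain ⟨M, hM, hosc⟩ := hX.exists_lintegral_oscillation_le hmean
  let o : ℕ → Ω → ℝ≥0∞ := fun n ω => ENNReal.ofReal (oscillation (fun u => X u ω) n (n + 1))
  have ho : ∀ n, Measurable (o n) := fun n => (hX.measurable_oscillation n (n + 1)).ennreal_ofReal
  -- By chaining, `|X|` up to time `t` is bounded by `|x|` plus the oscillations over the unit
  -- intervals begun by `t`. Discounting weights interval `n` by `e^{-qn}`, and the geometric series
  -- converges.
  let g : ℝ≥0 → Ω → ℝ≥0∞ := fun t ω =>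
    ENNReal.ofReal |x| + ∑' n : ℕ, (Ici (n : ℝ≥0)).indicator (fun _ => o n ω) t
  have hg : ∀ ω, ∫⁻ t, g t ω ∂discountMeasure q
      = ENNReal.ofReal |x| + ∑' n : ℕ, o n ω * ENNReal.ofReal (Real.exp (-q * n)) := fun ω => by
    simp only [g]
    rw [lintegral_add_left measurable_const, lintegral_const, measure_univ, mul_one,
      lintegral_tsum fun n => (measurable_const.indicator measurableSet_Ici).aemeasurable]
    congr 2
    ext n
    rw [lintegral_indicator_const measurableSet_Ici, discountMeasure_Ici hq, NNReal.coe_natCast]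
  refine ⟨g, fun ω s t hst => ?_, fun ω => ?_, ?_, ?_⟩
  · have h1 := (hX.isCadlagPath ω).abs_le_sum_oscillation s
    rw [hX.start] at h1
    refine (ENNReal.ofReal_le_ofReal h1).trans ?_
    rw [ENNReal.ofReal_add (abs_nonneg _) (Finset.sum_nonneg fun _ _ => oscillation_nonneg),
      ENNReal.ofReal_sum_of_nonneg fun _ _ => oscillation_nonneg]
    refine add_le_add_right ?_ _
    refine le_trans (Finset.sum_le_sum fun n hn => ?_)
      (ENNReal.sum_le_tsum (Finset.range (⌊s⌋₊ + 1)))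
    rw [indicator_of_mem]
    have h2 : n ≤ ⌊s⌋₊ := Nat.lt_succ_iff.1 (Finset.mem_range.1 hn)
    have h3 : (⌊s⌋₊ : ℝ≥0) ≤ s := Nat.floor_le zero_le
    exact ((Nat.cast_le.2 h2).trans h3).trans hst
  · have h1 : ∀ n : ℕ, Measurable ((Ici (n : ℝ≥0)).indicator fun _ => o n ω) := fun n =>
      measurable_const.indicator measurableSet_Ici
    exact measurable_const.add (Measurable.tsum h1)
  · simp_rw [hg]
    exact measurable_const.add (Measurable.tsum fun n => (ho n).mul_const _)
  · simp_rw [hg]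
    rw [lintegral_add_left measurable_const, lintegral_const, measure_univ, mul_one,
      lintegral_tsum fun n => ((ho n).mul_const _).aemeasurable]
    refine ENNReal.add_ne_top.2 ⟨ENNReal.ofReal_ne_top, ?_⟩
    have h3 : ∑' n : ℕ, ∫⁻ ω, o n ω * ENNReal.ofReal (Real.exp (-q * n)) ∂P
        ≤ ∑' n : ℕ, M * ENNReal.ofReal (Real.exp (-q * n)) := by
      refine ENNReal.tsum_le_tsum fun n => ?_
      rw [lintegral_mul_const _ (ho n)]
      gcongr
      exact hosc n
    refine ne_top_of_le_ne_top ?_ h3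
    rw [ENNReal.tsum_mul_left]
    refine ENNReal.mul_ne_top hM ?_
    have h4 : Summable fun n : ℕ => Real.exp (-q * n) := by
      have := summable_geometric_of_lt_one (Real.exp_nonneg (-q))
        (Real.exp_zero ▸ Real.exp_lt_exp.2 (by linarith))
      refine this.congr fun n => ?_
      rw [← Real.exp_nat_mul, mul_comm]
    rw [← ENNReal.ofReal_tsum_of_nonneg (fun n => Real.exp_nonneg _) h4]
    exact ENNReal.ofReal_ne_top

end IsSpectrallyNegativeLevy

/-! ### Spectrally negative Lévy processes are unbounded below -/

section PathLemmas

variable {f g : ℝ≥0 → ℝ}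

lemma monotone_of_monotone_denseSeq (hf : ∀ t, ContinuousWithinAt f (Ici t) t)
    (h : ∀ i j, TopologicalSpace.denseSeq ℝ≥0 i ≤ TopologicalSpace.denseSeq ℝ≥0 j →
      f (TopologicalSpace.denseSeq ℝ≥0 i) ≤ f (TopologicalSpace.denseSeq ℝ≥0 j)) :
    Monotone f := by
  intro s t hst
  rcases hst.eq_or_lt with rfl | hst
  · exact le_rfl
  by_contra! hcon
  obtain ⟨m, hm1, hm2⟩ := exists_between hcon
  have h1 := ((hf s).mono_left (nhdsWithin_mono _ Ioi_subset_Ici_self)).eventually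
    (Ioi_mem_nhds hm2)
  have h2 := ((hf t).mono_left (nhdsWithin_mono _ Ioi_subset_Ici_self)).eventually
    (Iio_mem_nhds hm1)
  obtain ⟨b, hb, hb'⟩ := (mem_nhdsGT_iff_exists_Ioo_subset' hst).1 h1
  obtain ⟨b₂, hb₂, hb₂'⟩ := (mem_nhdsGT_iff_exists_Ioo_subset' (lt_add_one t)).1 h2
  have hd := TopologicalSpace.denseRange_denseSeq ℝ≥0
  obtain ⟨_, ⟨i, rfl⟩, hi1, hi2⟩ := hd.exists_between (lt_min (show s < b from hb) hst)
  obtain ⟨_, ⟨j, rfl⟩, hj1, hj2⟩ := hd.exists_between (show t < b₂ from hb₂)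
  have h3 := h i j ((hi2.trans_le (min_le_right _ _)).trans hj1).le
  have h4 : m < f (TopologicalSpace.denseSeq ℝ≥0 i) := hb' ⟨hi1, hi2.trans_le (min_le_left _ _)⟩
  have h5 : f (TopologicalSpace.denseSeq ℝ≥0 j) < m := hb₂' ⟨hj1, hj2⟩
  linarith

lemma eq_of_eq_denseSeq (hf : ∀ t, ContinuousWithinAt f (Ici t) t)
    (hg : ∀ t, ContinuousWithinAt g (Ici t) t)
    (h : ∀ i, f (TopologicalSpace.denseSeq ℝ≥0 i) = g (TopologicalSpace.denseSeq ℝ≥0 i)) :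
    f = g := by
  ext t
  have h1 : Tendsto (fun s => f s - g s) (𝓝[>] t) (𝓝 (f t - g t)) :=
    ((hf t).sub (hg t)).mono_left (nhdsWithin_mono _ Ioi_subset_Ici_self)
  have h2 : ∃ᶠ s in 𝓝[>] t, f s - g s = 0 := by
    rw [Filter.Frequently, (nhdsGT_basis t).eventually_iff]
    rintro ⟨b, hb, hb'⟩
    obtain ⟨_, ⟨i, rfl⟩, hi⟩ :=
      (TopologicalSpace.denseRange_denseSeq ℝ≥0).exists_between hb
    exact hb' hi (sub_eq_zero.2 (h i))
  refine sub_eq_zero.1 ?_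
  by_contra hne
  exact h2 (h1.eventually_ne hne)

/-- Squeezing `n * t` between consecutive integers bounds `n * |f t - f 1 * t|` by `f 1` for every
`n`. -/
lemma eq_mul_one_of_additive_of_monotone (hf : Monotone f) (h : ∀ s t, f (s + t) = f s + f t)
    (t : ℝ≥0) : f t = f 1 * t := by
  have h0 : f 0 = 0 := by simpa using h 0 0
  have hn : ∀ (n : ℕ) (s : ℝ≥0), f (n * s) = n * f s := by
    intro n s
    induction n with
    | zero => simp [h0]
    | succ n ih => push_cast; rw [add_mul, h, ih]; simp [add_mul]
  have h1 : 0 ≤ f 1 := h0 ▸ hf zero_le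
  have key : ∀ n : ℕ, n * |f t - f 1 * t| ≤ f 1 := by
    intro n
    have h2 : (⌊n * t⌋₊ : ℝ≥0) ≤ n * t := Nat.floor_le zero_le
    have h3 : n * t ≤ ((⌊n * t⌋₊ + 1 : ℕ) : ℝ≥0) := by
      push_cast; exact (Nat.lt_floor_add_one _).le
    have h4 := hf h2
    have h5 := hf h3
    have h6 := hn ⌊n * t⌋₊ 1
    have h7 := hn (⌊n * t⌋₊ + 1) 1
    rw [mul_one] at h6 h7
    rw [h6, hn] at h4
    rw [h7, hn] at h5
    have h2' : (⌊n * t⌋₊ : ℝ) ≤ n * t := by exact_mod_cast h2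
    have h3' : (n * t : ℝ) ≤ ⌊n * t⌋₊ + 1 := by exact_mod_cast h3
    push_cast at h5
    rw [← Nat.abs_cast n, ← abs_mul, abs_le]
    have h8 := mul_le_mul_of_nonneg_right h2' h1
    have h9 := mul_le_mul_of_nonneg_right h3' h1
    constructor <;> nlinarith
  by_contra hne
  have hpos : 0 < |f t - f 1 * t| := abs_pos.2 (sub_ne_zero.2 hne)
  obtain ⟨n, hlarge⟩ := exists_nat_gt (f 1 / |f t - f 1 * t|)
  exact absurd (key n) (not_le.2 ((div_lt_iff₀ hpos).1 hlarge))

/-- The truncated increments of a monotone continuous path sum up to the total increment if the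
partition is fine enough. -/
lemma eventually_sum_truncated_eq (hf : Monotone f) (hc : Continuous f) (t : ℝ≥0) {ε : ℝ}
    (hε : 0 < ε) : ∀ᶠ n : ℕ in atTop, ∑ k ∈ Finset.range (n + 1),
      min (max (f (t * (k + 1 : ℕ) / (n + 1)) - f (t * k / (n + 1))) 0) ε = f t - f 0 := by
  have huc := (isCompact_Icc (a := (0 : ℝ≥0)) (b := t)).uniformContinuousOn_of_continuous
    hc.continuousOn
  obtain ⟨δ, hδ, hδ'⟩ := Metric.uniformContinuousOn_iff.1 huc ε hε
  have h1 : Tendsto (fun n : ℕ => (t : ℝ) * (1 / ((n : ℝ) + 1))) atTop (𝓝 0) := by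
    simpa using tendsto_one_div_add_atTop_nhds_zero_nat.const_mul (t : ℝ)
  filter_upwards [h1.eventually (Iio_mem_nhds hδ)] with n hn
  have h2 : ∀ k ∈ Finset.range (n + 1),
      min (max (f (t * (k + 1 : ℕ) / (n + 1)) - f (t * k / (n + 1))) 0) ε
        = f (t * (k + 1 : ℕ) / (n + 1)) - f (t * k / (n + 1)) := by
    intro k hk
    have hk' : k + 1 ≤ n + 1 := Finset.mem_range.1 hk
    have hle : t * k / (n + 1) ≤ t * (k + 1 : ℕ) / (n + 1) := by
      gcongr
      exact k.le_succ
    have hmem : ∀ j : ℕ, j ≤ n + 1 → t * j / (n + 1) ∈ Icc 0 t := fun j hj => by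
      refine ⟨zero_le, div_le_of_le_mul₀ zero_le zero_le ?_⟩
      gcongr
      exact_mod_cast hj
    have h3 := hδ' _ (hmem (k + 1) hk') _ (hmem k (by omega)) (by
      rw [NNReal.dist_eq]
      push_cast
      have : (t : ℝ) * (k + 1) / (n + 1) - t * k / (n + 1) = t * (1 / ((n : ℝ) + 1)) := by ring
      rw [this, abs_of_nonneg (by positivity)]
      exact hn)
    rw [max_eq_left (sub_nonneg.2 (hf hle)), min_eq_left]
    rw [Real.dist_eq] at h3
    exact (le_abs_self _).trans h3.le
  rw [Finset.sum_congr rfl h2,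
    Finset.sum_range_sub (fun k : ℕ => f (t * k / (n + 1))) (n + 1)]
  congr 2
  · have : ((n : ℝ≥0) + 1) ≠ 0 := by positivity
    push_cast
    exact mul_div_cancel_right₀ t this
  · simp

end PathLemmas

namespace IsSpectrallyNegativeLevy

variable {Ω : Type*} [mΩ : MeasurableSpace Ω] {P : Measure Ω} {X : ℝ≥0 → Ω → ℝ} {x : ℝ}

lemma ae_increment_nonneg (hX : IsSpectrallyNegativeLevy X P x)
    (h : ∀ t, ∀ᵐ ω ∂P, x ≤ X t ω) {s t : ℝ≥0} (hst : s ≤ t) : ∀ᵐ ω ∂P, X s ω ≤ X t ω := by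
  have h1 := hX.measure_increment hst (measurableSet_Iio (a := (0 : ℝ)))
  have h2 : P {ω | X (t - s) ω - x ∈ Iio 0} = 0 := by
    refine measure_mono_null (fun ω hω => ?_) (h (t - s))
    have h3 : X (t - s) ω - x < 0 := hω
    exact fun h4 : x ≤ X (t - s) ω => by linarith
  rw [h2] at h1
  refine measure_mono_null (fun ω hω => ?_) h1
  have h3 : ¬ X s ω ≤ X t ω := hω
  exact sub_neg.2 (not_le.1 h3)

lemma ae_monotone_continuous (hX : IsSpectrallyNegativeLevy X P x)
    (h : ∀ t, ∀ᵐ ω ∂P, x ≤ X t ω) :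
    ∀ᵐ ω ∂P, Monotone (fun t => X t ω) ∧ Continuous fun t => X t ω := by
  have h1 : ∀ᵐ ω ∂P, ∀ i j, TopologicalSpace.denseSeq ℝ≥0 i ≤ TopologicalSpace.denseSeq ℝ≥0 j →
      X (TopologicalSpace.denseSeq ℝ≥0 i) ω ≤ X (TopologicalSpace.denseSeq ℝ≥0 j) ω :=
    ae_all_iff.2 fun i => ae_all_iff.2 fun j => by
      by_cases hij : TopologicalSpace.denseSeq ℝ≥0 i ≤ TopologicalSpace.denseSeq ℝ≥0 j
      · filter_upwards [hX.ae_increment_nonneg h hij] with ω hω _ using hω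
      · exact ae_of_all _ fun ω h => absurd h hij
  filter_upwards [h1, hX.no_positive_jumps] with ω hω hω'
  have hm := monotone_of_monotone_denseSeq (hX.right_continuous ω) hω
  refine ⟨hm, continuous_iff_continuousAt.2 fun t => ?_⟩
  rw [continuousAt_iff_continuous_left'_right']
  exact ⟨hm.continuousWithinAt_Iio_iff_leftLim_eq.2 (le_antisymm (hm.leftLim_le le_rfl) (hω' t)),
    (hX.right_continuous ω t).mono Ioi_subset_Ici_self⟩

variable [IsProbabilityMeasure P]

lemma integrable (hX : IsSpectrallyNegativeLevy X P x) (hmean : Integrable (X 1) P) (t : ℝ≥0) :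
    Integrable (X t) P := by
  obtain ⟨M, hM, hosc⟩ := hX.exists_lintegral_oscillation_le hmean
  have h1 : ∀ n : ℕ, Integrable (fun ω => oscillation (fun u => X u ω) n (n + 1)) P := fun n =>
    ⟨(hX.measurable_oscillation _ _).aestronglyMeasurable, by
      rw [hasFiniteIntegral_iff_ofReal (ae_of_all _ fun ω => oscillation_nonneg)]
      exact (hosc n).trans_lt hM.lt_top⟩
  refine Integrable.mono' (g := fun ω => |x| + ∑ k ∈ Finset.range (⌊t⌋₊ + 1),
    oscillation (fun u => X u ω) k (k + 1))
    ((integrable_const _).add (integrable_finsetSum _ fun n _ => h1 n))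
    (hX.measurable t).aestronglyMeasurable (ae_of_all _ fun ω => ?_)
  have := (hX.isCadlagPath ω).abs_le_sum_oscillation t
  rwa [hX.start] at this

/-- A spectrally negative Lévy process with non-decreasing paths has deterministic marginals. -/
lemma ae_eq_integral_of_nonneg (hX : IsSpectrallyNegativeLevy X P x) (hmean : Integrable (X 1) P)
    (h : ∀ t, ∀ᵐ ω ∂P, x ≤ X t ω) (t : ℝ≥0) : ∀ᵐ ω ∂P, X t ω - x = ∫ ω, (X t ω - x) ∂P := by
  set μ := ∫ ω, (X t ω - x) ∂P with hμ
  have hint : Integrable (fun ω => X t ω - x) P := (hX.integrable hmean t).sub (integrable_const x)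
  have hμ0 : 0 ≤ μ := integral_nonneg_of_ae ((h t).mono fun ω hω => sub_nonneg.2 hω)
  let ξ : ℕ → ℕ → Ω → ℝ := fun n k ω => X (t * (k + 1 : ℕ) / (n + 1)) ω - X (t * k / (n + 1)) ω
  have hξm : ∀ n k, Measurable (ξ n k) := fun n k => (hX.measurable _).sub (hX.measurable _)
  have hξi : ∀ n k, Integrable (ξ n k) P := fun n k =>
    (hX.integrable hmean _).sub (hX.integrable hmean _)
  have hξ0 : ∀ᵐ ω ∂P, ∀ n k, 0 ≤ ξ n k ω := by
    filter_upwards [hX.ae_monotone_continuous h] with ω hω n k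
    refine sub_nonneg.2 (hω.1 ?_)
    gcongr
    exact k.le_succ
  have hξs : ∀ n ω, ∑ k ∈ Finset.range (n + 1), ξ n k ω = X t ω - x := fun n ω => by
    have h1 : t * ((n + 1 : ℕ) : ℝ≥0) / (n + 1) = t := by
      have : ((n : ℝ≥0) + 1) ≠ 0 := by positivity
      push_cast
      exact mul_div_cancel_right₀ t this
    rw [Finset.sum_range_sub (fun k : ℕ => X (t * k / (n + 1)) ω) (n + 1), h1]
    simp [hX.start]
  -- The increments over a uniform partition are clipped at `ε`. The clipped ones are independent
  -- with second moments at most `ε` times the mean increments, so their sum has variance at most `ε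
  -- * μ`. By path continuity this sum is eventually `X t - x`, and Fatou's lemma passes to the
  -- limit.
  have key : ∀ ε : ℝ, 0 < ε → ∫⁻ ω, ENNReal.ofReal ((X t ω - x - μ) ^ 2) ∂P
      ≤ ENNReal.ofReal (ε * μ) := by
    intro ε hε
    let g : ℝ → ℝ := fun z => min (max z 0) ε
    have hg : Measurable g := (measurable_id.max measurable_const).min measurable_const
    have hg0 : ∀ z, 0 ≤ g z := fun z => le_min (le_max_right _ _) hε.le
    have hgε : ∀ z, g z ≤ ε := fun z => min_le_right _ _
    have hgz : ∀ z, 0 ≤ z → g z ≤ z := fun z hz => (min_le_left _ _).trans_eq (max_eq_left hz)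
    have hL2 : ∀ n k, MemLp (fun ω => g (ξ n k ω)) 2 P := fun n k =>
      MemLp.of_bound (hg.comp (hξm n k)).aestronglyMeasurable ε (ae_of_all _ fun ω => by
        rw [Real.norm_of_nonneg (hg0 _)]
        exact hgε _)
    let S : ℕ → Ω → ℝ := fun n => ∑ k ∈ Finset.range (n + 1), fun ω => g (ξ n k ω)
    have hSapp : ∀ n ω, S n ω = ∑ k ∈ Finset.range (n + 1), g (ξ n k ω) := fun n ω => by
      simp [S]
    have hSL2 : ∀ n, MemLp (S n) 2 P := fun n => memLp_finsetSum' _ fun k _ => hL2 n k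
    have hvar : ∀ n, Var[S n; P] ≤ ε * μ := by
      intro n
      have hind : iIndepFun (ξ n) P := by
        refine hX.indep_increments.nat (t := fun k : ℕ => t * k / (n + 1)) fun i j hij => ?_
        simp only
        gcongr
      rw [IndepFun.variance_sum (fun k _ => hL2 n k) fun i _ j _ hij =>
        (hind.indepFun hij).comp hg hg]
      calc ∑ k ∈ Finset.range (n + 1), Var[fun ω => g (ξ n k ω); P]
          ≤ ∑ k ∈ Finset.range (n + 1), ∫ ω, ε * ξ n k ω ∂P := by
            refine Finset.sum_le_sum fun k _ => ?_
            refine (variance_le_expectation_sq (hg.comp (hξm n k)).aestronglyMeasurable).trans ?_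
            refine integral_mono_ae ((hL2 n k).integrable_sq) ((hξi n k).const_mul ε) ?_
            filter_upwards [hξ0] with ω hω
            simp only [Pi.pow_apply]
            rw [sq]
            exact mul_le_mul (hgε _) (hgz _ (hω n k)) (hg0 _) hε.le
        _ = ε * μ := by
            rw [← integral_finsetSum _ fun k _ => (hξi n k).const_mul ε]
            simp_rw [← Finset.mul_sum, hξs]
            rw [integral_const_mul]
    have hlim : ∀ᵐ ω ∂P, Tendsto (fun n => S n ω) atTop (𝓝 (X t ω - x)) := by
      filter_upwards [hX.ae_monotone_continuous h] with ω hω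
      refine tendsto_const_nhds.congr' ?_
      filter_upwards [eventually_sum_truncated_eq hω.1 hω.2 t hε] with n hn
      rw [hSapp, ← hX.start ω, ← hn]
    have hmlim : Tendsto (fun n => ∫ ω, S n ω ∂P) atTop (𝓝 μ) := by
      refine tendsto_integral_of_dominated_convergence (fun ω => X t ω - x)
        (fun n => (hSL2 n).aestronglyMeasurable) hint (fun n => ?_) hlim
      filter_upwards [hξ0] with ω hω
      rw [hSapp, Real.norm_of_nonneg (Finset.sum_nonneg fun k _ => hg0 _), ← hξs n ω]
      exact Finset.sum_le_sum fun k _ => hgz _ (hω n k)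
    have hfatou := lintegral_liminf_le' (μ := P) (u := atTop)
      (f := fun n ω => ENNReal.ofReal ((S n ω - ∫ ω, S n ω ∂P) ^ 2)) fun n =>
        (((hSL2 n).aestronglyMeasurable.aemeasurable.sub_const _).pow_const 2).ennreal_ofReal
    refine le_trans (le_of_eq (lintegral_congr_ae ?_)) (hfatou.trans ?_)
    · filter_upwards [hlim] with ω hω
      exact ((ENNReal.continuous_ofReal.tendsto _).comp ((hω.sub hmlim).pow 2)).liminf_eq.symm
    · refine liminf_le_of_le (by isBoundedDefault) fun b hb => ?_
      obtain ⟨n, hn⟩ := hb.exists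
      refine hn.trans ?_
      rw [← evariance_eq_lintegral_ofReal, ← (hSL2 n).ofReal_variance_eq]
      exact ENNReal.ofReal_le_ofReal (hvar n)
  have hzero : ∫⁻ ω, ENNReal.ofReal ((X t ω - x - μ) ^ 2) ∂P = 0 := by
    have h1 : Tendsto (fun n : ℕ => ENNReal.ofReal (1 / ((n : ℝ) + 1) * μ)) atTop (𝓝 0) := by
      have h2 := (tendsto_one_div_add_atTop_nhds_zero_nat (𝕜 := ℝ)).mul_const μ
      rw [zero_mul] at h2
      have h3 := (ENNReal.continuous_ofReal.tendsto _).comp h2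
      rwa [ENNReal.ofReal_zero] at h3
    exact le_antisymm (ge_of_tendsto' h1 fun n => key _ (by positivity)) zero_le
  rw [lintegral_eq_zero_iff
    ((((hX.measurable t).sub_const x).sub_const μ).pow_const 2).ennreal_ofReal] at hzero
  filter_upwards [hzero] with ω hω
  have h1 : (X t ω - x - μ) ^ 2 ≤ 0 := ENNReal.ofReal_eq_zero.1 hω
  have h2 : X t ω - x - μ = 0 := by
    have := le_antisymm h1 (sq_nonneg _)
    simpa using this
  linarith

/-- Otherwise every marginal is deterministic, its mean is additive and monotone in time, and the
paths are linear. -/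
lemma exists_measure_lt_pos (hX : IsSpectrallyNegativeLevy X P x) (hmean : Integrable (X 1) P) :
    ∃ t, 0 < P {ω | X t ω < x} := by
  by_contra! hcon
  have h : ∀ t, ∀ᵐ ω ∂P, x ≤ X t ω := fun t => by
    refine measure_mono_null (fun ω hω => ?_) (le_antisymm (hcon t) zero_le)
    exact not_le.1 (show ¬ x ≤ X t ω from hω)
  let m : ℝ≥0 → ℝ := fun t => ∫ ω, (X t ω - x) ∂P
  have hadd : ∀ s t, m (s + t) = m s + m t := by
    intro s t
    have h1 : ∫ ω, (X (s + t) ω - X s ω) ∂P = m t := by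
      have h2 : ∫ z, z ∂(P.map fun ω => X (s + t) ω - X s ω)
          = ∫ z, z ∂(P.map fun ω => X t ω - X 0 ω) := by rw [hX.stationary_increments s t]
      rw [integral_map (φ := fun ω => X (s + t) ω - X s ω) (f := fun z : ℝ => z)
          ((hX.measurable _).sub (hX.measurable _)).aemeasurable aestronglyMeasurable_id,
        integral_map (φ := fun ω => X t ω - X 0 ω) (f := fun z : ℝ => z)
          ((hX.measurable _).sub (hX.measurable _)).aemeasurable aestronglyMeasurable_id] at h2
      simpa only [hX.start] using! h2
    have h2 := integral_add (f := fun ω => X s ω - x) (g := fun ω => X (s + t) ω - X s ω)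
      ((hX.integrable hmean s).sub (integrable_const x))
      ((hX.integrable hmean _).sub (hX.integrable hmean s))
    rw [h1] at h2
    refine Eq.trans ?_ h2
    refine integral_congr_ae (ae_of_all _ fun ω => ?_)
    simp only
    ring
  have hmono : Monotone m := fun s t hst => by
    refine integral_mono_ae ((hX.integrable hmean s).sub (integrable_const x))
      ((hX.integrable hmean t).sub (integrable_const x)) ?_
    filter_upwards [hX.ae_increment_nonneg h hst] with ω hω
    exact sub_le_sub_right hω x
  have hlin := eq_mul_one_of_additive_of_monotone hmono hadd
  have hpath : ∀ᵐ ω ∂P, ∀ t : ℝ≥0, X t ω = x + m 1 * t := by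
    have h1 : ∀ᵐ ω ∂P, ∀ i, X (TopologicalSpace.denseSeq ℝ≥0 i) ω - x
        = m (TopologicalSpace.denseSeq ℝ≥0 i) :=
      ae_all_iff.2 fun i => hX.ae_eq_integral_of_nonneg hmean h _
    filter_upwards [h1] with ω hω
    refine congrFun (eq_of_eq_denseSeq (hX.right_continuous ω) (fun t => ?_) fun i => ?_)
    · fun_prop
    · rw [← hlin, ← hω i]
      ring
  have hm1 : 0 ≤ m 1 := by
    have h0 : m 0 = 0 := by simpa using hadd 0 0
    exact h0 ▸ hmono zero_le
  -- Slope zero gives constant paths, which are antitone and so excluded as the negative of a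
  -- subordinator.
  rcases hm1.eq_or_lt with h0 | h0
  · refine hX.not_neg_subordinator ?_
    filter_upwards [hpath] with ω hω s t _
    simp [hω, ← h0]
  · exact hX.not_drift ⟨m 1, h0, hpath⟩

/-- Started afresh at any time, the process falls below any level with positive probability. -/
lemma exists_measure_increment_lt_pos (hX : IsSpectrallyNegativeLevy X P x)
    (hmean : Integrable (X 1) P) (K : ℝ) :
    ∃ T : ℝ≥0, ∀ s, 0 < P {ω | X (s + T) ω - X s ω < K} := by
  obtain ⟨t, ht⟩ := hX.exists_measure_lt_pos hmean
  obtain ⟨ε, hε, hp⟩ : ∃ ε : ℝ, 0 < ε ∧ 0 < P {ω | X t ω - x ∈ Iio (-ε)} := by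
    by_contra! hcon
    have h1 : {ω | X t ω < x} ⊆ ⋃ n : ℕ, {ω | X t ω - x ∈ Iio (-(1 / ((n : ℝ) + 1)))} := by
      intro ω hω
      obtain ⟨n, hn⟩ := exists_nat_one_div_lt (sub_pos.2 (show X t ω < x from hω))
      refine mem_iUnion.2 ⟨n, ?_⟩
      change X t ω - x < -(1 / ((n : ℝ) + 1))
      linarith
    refine absurd (measure_mono_null h1 (measure_iUnion_null fun n => ?_)) ht.ne'
    exact le_antisymm (hcon _ (by positivity)) zero_le
  -- Drops by more than `ε` over `n` successive intervals of length `t` are independent, each of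
  -- positive probability.
  have key : ∀ n : ℕ, 0 < P {ω | X (n * t) ω - x ≤ -(n * ε)} := by
    intro n
    induction n with
    | zero => simp [hX.start]
    | succ n ih =>
      have hle : (n : ℝ≥0) * t ≤ (n + 1 : ℕ) * t := by gcongr; exact n.le_succ
      have h1 := measure_inter_increment hX.measurable hX.start hX.indep_increments hle
        (A := {ω | X (n * t) ω - x ≤ -(n * ε)})
        (((measurable_naturalFiltration hX.measurable le_rfl).sub_const x) measurableSet_Iic)
        (measurableSet_Iio (a := -ε))
      have h2 : ((n + 1 : ℕ) : ℝ≥0) * t - n * t = t := by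
        push_cast
        rw [add_mul, one_mul, add_tsub_cancel_left]
      rw [hX.measure_increment hle measurableSet_Iio, h2] at h1
      refine (h1 ▸ ENNReal.mul_pos ih.ne' hp.ne').trans_le (measure_mono ?_)
      rintro ω ⟨h3, h4⟩
      have h3' : X (n * t) ω - x ≤ -(n * ε) := h3
      have h4' : X ((n + 1 : ℕ) * t) ω - X (n * t) ω < -ε := h4
      change X ((n + 1 : ℕ) * t) ω - x ≤ -((n + 1 : ℕ) * ε)
      push_cast at h4' ⊢
      linarith
  obtain ⟨n, hn⟩ := exists_nat_gt (-K / ε)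
  refine ⟨n * t, fun s => ?_⟩
  have h1 := hX.measure_increment (le_add_of_nonneg_right (a := s) (zero_le (a := n * t)))
    (measurableSet_Iio (a := K))
  rw [add_tsub_cancel_left] at h1
  change 0 < P {ω | X (s + n * t) ω - X s ω ∈ Iio K}
  rw [h1]
  refine (key n).trans_le (measure_mono fun ω hω => ?_)
  have h2 : X (n * t) ω - x ≤ -(n * ε) := hω
  have h3 := (div_lt_iff₀ hε).1 hn
  change X (n * t) ω - x < K
  linarith

end IsSpectrallyNegativeLevy

/-! ### Pathwise comparison of payoffs -/

open Classical in
/-- The discounted transaction costs along a path. -/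
def pathCosts (q c : ℝ) (d : ℝ≥0 → ℝ) : ℝ≥0∞ :=
  ∑' t : ℝ≥0, if 0 < jumpAt d t then ENNReal.ofReal (Real.exp (-q * t) * c) else 0

/-- The discounted dividends along a path. -/
def pathDividends (q : ℝ) (d : ℝ≥0 → ℝ) : ℝ≥0∞ :=
  ∑' t : ℝ≥0, ENNReal.ofReal (Real.exp (-q * t) * jumpAt d t)

/-- The discounted injections along a path. -/
def pathInjection (q : ℝ) (r : ℝ≥0 → ℝ) : ℝ≥0∞ :=
  ∫⁻ t, ENNReal.ofReal (r t) ∂discountMeasure q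

section Compare

variable {q c : ℝ} {d y r : ℝ≥0 → ℝ}

lemma IsDividendPath.pathDividends_eq (hq : 0 < q) (hd : IsDividendPath d) :
    pathDividends q d = ∫⁻ t, ENNReal.ofReal (d t) ∂discountMeasure q := by
  rw [pathDividends, hd.isJumpFamily.tsum_exp_mul hq, hd.jumpSum_jumpAt]

/-- The pathwise saving `reg_trimmed_add_le`, combined with minimality of `reg`, averaged over the
exponential time. -/
lemma tsum_excess_add_le (hq : 0 < q) (hc : 0 < c) (hd : IsDividendPath d) (hy : IsCadlagPath y)
    (hy0 : 0 ≤ y 0) (hr : Monotone r) (hr0 : r 0 = 0) (h : ∀ t, 0 ≤ y t - d t + r t) :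
    ∑' s : ℝ≥0, ENNReal.ofReal (Real.exp (-q * s) * excess d y s)
      + pathInjection q (reg (jumpSum (trimmed c d y)) y) ≤ pathInjection q r := by
  have hF := isJumpFamily_excess hd hy
  rw [hF.tsum_exp_mul hq, pathInjection, pathInjection,
    ← lintegral_add_left hF.mono.measurable.ennreal_ofReal]
  refine lintegral_mono fun t => ?_
  rw [← ENNReal.ofReal_add (hF.jumpSum_nonneg t) (reg_nonneg t), add_comm]
  exact ENNReal.ofReal_le_ofReal ((reg_trimmed_add_le hc hd hy hy0 t).trans
    (reg_le_of_reserve_nonneg hr hr0 h t))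

/-- A kept lump is its trimmed part plus its excess, at equal cost; a dropped lump is at most `c`
plus its excess. The terms are arranged to avoid truncated subtraction. -/
lemma lump_trade_off (hc : 0 < c) (hd : Monotone d) (s : ℝ≥0) :
    ENNReal.ofReal (Real.exp (-q * s) * jumpAt d s)
      + (if 0 < trimmed c d y s then ENNReal.ofReal (Real.exp (-q * s) * c) else 0)
    ≤ ENNReal.ofReal (Real.exp (-q * s) * trimmed c d y s)
      + (if 0 < jumpAt d s then ENNReal.ofReal (Real.exp (-q * s) * c) else 0)
      + ENNReal.ofReal (Real.exp (-q * s) * excess d y s) := by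
  have hw := Real.exp_pos (-q * s)
  by_cases h : c < jumpAt d s - excess d y s
  · have h1 : trimmed c d y s = jumpAt d s - excess d y s := if_pos h
    have h2 := excess_nonneg (d := d) (y := y) s
    rw [if_pos (by linarith), if_pos (by linarith), h1, add_right_comm,
      ← ENNReal.ofReal_add (mul_nonneg hw.le (by linarith)) (mul_nonneg hw.le h2), ← mul_add,
      sub_add_cancel]
  · have h1 : trimmed c d y s = 0 := if_neg h
    rw [h1, if_neg (lt_irrefl _), add_zero, mul_zero, ENNReal.ofReal_zero, zero_add]
    rcases (jumpAt_nonneg hd s).eq_or_lt with h0 | h0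
    · rw [← h0, mul_zero, ENNReal.ofReal_zero]
      exact zero_le
    · rw [if_pos h0, ← ENNReal.ofReal_add (mul_pos hw hc).le (mul_nonneg hw.le (excess_nonneg s)),
        ← mul_add]
      refine ENNReal.ofReal_le_ofReal (mul_le_mul_of_nonneg_left ?_ hw.le)
      linarith

lemma pathDividends_add_pathCosts_le (hc : 0 < c) (hd : IsDividendPath d) (hy : IsCadlagPath y) :
    pathDividends q d + pathCosts q c (jumpSum (trimmed c d y))
      ≤ pathDividends q (jumpSum (trimmed c d y)) + pathCosts q c d
        + ∑' s : ℝ≥0, ENNReal.ofReal (Real.exp (-q * s) * excess d y s) := by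
  simp only [pathDividends, pathCosts, (isJumpFamily_trimmed hc hd hy).jumpAt_jumpSum]
  rw [← ENNReal.tsum_add, ← ENNReal.tsum_add, ← ENNReal.tsum_add]
  exact ENNReal.tsum_le_tsum fun s => lump_trade_off hc hd.mono s

/-- Trimming the dividends does not decrease the payoff. -/
lemma payoff_trimmed_le (hq : 0 < q) (hc : 0 < c) {φ : ℝ} (hφ : 1 < φ) (hd : IsDividendPath d)
    (hy : IsCadlagPath y) (hy0 : 0 ≤ y 0) (hr : Monotone r) (hr0 : r 0 = 0)
    (h : ∀ t, 0 ≤ y t - d t + r t) :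
    pathDividends q d + (pathCosts q c (jumpSum (trimmed c d y))
        + ENNReal.ofReal φ * pathInjection q (reg (jumpSum (trimmed c d y)) y))
      ≤ pathDividends q (jumpSum (trimmed c d y))
        + (pathCosts q c d + ENNReal.ofReal φ * pathInjection q r) := by
  have h1 := tsum_excess_add_le hq hc hd hy hy0 hr hr0 h
  have h2 := pathDividends_add_pathCosts_le (q := q) hc hd hy
  set E := ∑' s : ℝ≥0, ENNReal.ofReal (Real.exp (-q * s) * excess d y s)
  rw [← add_assoc, ← add_assoc]
  refine (add_le_add_left h2 _).trans ?_
  rw [add_assoc _ E]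
  refine add_le_add_right ?_ _
  refine le_trans ?_ (mul_le_mul_right h1 _)
  rw [mul_add]
  refine add_le_add_left ?_ _
  exact le_mul_of_one_le_left zero_le (ENNReal.one_le_ofReal.2 hφ.le)

/-- If trimming does not increase the payoff, then injections are minimal, nothing is paid in
excess, and all lump sums are at least `c`. -/
lemma eq_of_payoff_eq (hq : 0 < q) (hc : 0 < c) {φ : ℝ} (hφ : 1 < φ) (hd : IsDividendPath d)
    (hy : IsCadlagPath y) (hy0 : 0 ≤ y 0) (hr : Monotone r) (hr0 : r 0 = 0)
    (hrc : ∀ t, ContinuousWithinAt r (Ici t) t) (h : ∀ t, 0 ≤ y t - d t + r t)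
    (hdiv : pathDividends q d ≠ ∞) (hcost : pathCosts q c d ≠ ∞) (hinj : pathInjection q r ≠ ∞)
    (heq : pathDividends q d + (pathCosts q c (jumpSum (trimmed c d y))
        + ENNReal.ofReal φ * pathInjection q (reg (jumpSum (trimmed c d y)) y))
      = pathDividends q (jumpSum (trimmed c d y))
        + (pathCosts q c d + ENNReal.ofReal φ * pathInjection q r)) :
    r = reg (jumpSum (trimmed c d y)) y ∧ (∀ s, excess d y s = 0) ∧
      ∀ s, 0 < jumpAt d s → c ≤ jumpAt d s := by
  have hp := isJumpFamily_trimmed hc hd hy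
  have h1 := tsum_excess_add_le hq hc hd hy hy0 hr hr0 h
  have h2 := pathDividends_add_pathCosts_le (q := q) hc hd hy
  have hdiv' : pathDividends q (jumpSum (trimmed c d y)) ≠ ∞ := by
    refine ne_top_of_le_ne_top hdiv (ENNReal.tsum_le_tsum fun s => ENNReal.ofReal_le_ofReal ?_)
    rw [hp.jumpAt_jumpSum]
    exact mul_le_mul_of_nonneg_left (trimmed_le_jumpAt hd.mono hy s) (Real.exp_nonneg _)
  have hsum : pathDividends q d + pathCosts q c (jumpSum (trimmed c d y))
      = pathDividends q (jumpSum (trimmed c d y)) + pathCosts q c d ∧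
      ∑' s : ℝ≥0, ENNReal.ofReal (Real.exp (-q * s) * excess d y s) = 0 ∧
      pathInjection q r = pathInjection q (reg (jumpSum (trimmed c d y)) y) := by
    have hE := ne_top_of_le_ne_top hinj (le_self_add.trans h1)
    have hI := ne_top_of_le_ne_top hinj (le_add_self.trans h1)
    have hC : pathCosts q c (jumpSum (trimmed c d y)) ≠ ∞ :=
      ne_top_of_le_ne_top (ENNReal.add_ne_top.2 ⟨ENNReal.add_ne_top.2 ⟨hdiv', hcost⟩, hE⟩)
        (le_add_self.trans h2)
    generalize pathInjection q (reg (jumpSum (trimmed c d y)) y) = I' at *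
    generalize ∑' s : ℝ≥0, ENNReal.ofReal (Real.exp (-q * s) * excess d y s) = E at *
    generalize pathCosts q c (jumpSum (trimmed c d y)) = C' at *
    generalize pathDividends q (jumpSum (trimmed c d y)) = V' at *
    generalize pathDividends q d = V at *
    generalize pathCosts q c d = C at *
    generalize pathInjection q r = I at *
    lift I to ℝ≥0 using hinj
    lift I' to ℝ≥0 using hI
    lift E to ℝ≥0 using hE
    lift C to ℝ≥0 using hcost
    lift C' to ℝ≥0 using hC
    lift V to ℝ≥0 using hdiv
    lift V' to ℝ≥0 using hdiv'
    lift φ to ℝ≥0 using by linarith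
    rw [ENNReal.ofReal_coe_nnreal] at heq
    norm_cast at *
    simp only [← NNReal.coe_le_coe, ← NNReal.coe_inj, ← NNReal.coe_lt_coe, NNReal.coe_add,
      NNReal.coe_mul, NNReal.coe_zero, NNReal.coe_one] at *
    have hE0 := E.coe_nonneg
    -- The hypotheses give `φ (I - I') ≤ E ≤ I - I'`, which with `φ > 1` excludes `I' < I`. Then `E
    -- = 0`, and the dividend and cost terms balance.
    have h3 : (I : ℝ) ≤ I' := by
      by_contra! hlt
      nlinarith
    exact ⟨by nlinarith, by linarith, by linarith⟩
  obtain ⟨hs1, hs2, hs3⟩ := hsum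
  have hexc : ∀ s, excess d y s = 0 := fun s => by
    have h3 := ENNReal.ofReal_eq_zero.1 (ENNReal.tsum_eq_zero.1 hs2 s)
    have h4 := excess_nonneg (d := d) (y := y) s
    by_contra hne
    exact absurd h3 (not_le.2 (mul_pos (Real.exp_pos _) (lt_of_le_of_ne h4 (Ne.symm hne))))
  refine ⟨eq_of_ae_eq_discountMeasure hq hrc (fun t => reg_right_continuous hp.mono hy
    ((isFeasible_trimmed hc hd hy).rightLim_sub_le hp.mono hy t)) ?_, hexc, fun s hs => ?_⟩
  · have hle : ∀ t, ENNReal.ofReal (reg (jumpSum (trimmed c d y)) y t) ≤ ENNReal.ofReal (r t) := by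
      intro t
      have h3 := reg_trimmed_add_le hc hd hy hy0 t
      have h4 := reg_le_of_reserve_nonneg hr hr0 h t
      have h5 := (isJumpFamily_excess hd hy).jumpSum_nonneg t
      exact ENNReal.ofReal_le_ofReal (by linarith)
    have h6 := ae_eq_of_ae_le_of_lintegral_le (ae_of_all _ hle)
      (show pathInjection q (reg (jumpSum (trimmed c d y)) y) ≠ ∞ from hs3 ▸ hinj)
      hr.measurable.ennreal_ofReal.aemeasurable hs3.le
    filter_upwards [h6] with t ht
    exact ((ENNReal.ofReal_eq_ofReal_iff (reg_nonneg t) (hr0 ▸ hr zero_le)).1 ht).symm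
  · by_contra! hlt
    have ht : trimmed c d y s = 0 := if_neg (by rw [hexc]; linarith)
    -- Dropping a lump strictly below `c` makes one term of the comparison strict, and the sums are
    -- finite.
    have hlt' : pathDividends q d + pathCosts q c (jumpSum (trimmed c d y))
        < pathDividends q (jumpSum (trimmed c d y)) + pathCosts q c d := by
      have hfin : pathDividends q d + pathCosts q c (jumpSum (trimmed c d y)) ≠ ∞ := by
        rw [hs1]; exact ENNReal.add_ne_top.2 ⟨hdiv', hcost⟩
      simp only [pathDividends, pathCosts, hp.jumpAt_jumpSum] at hfin ⊢
      rw [← ENNReal.tsum_add] at hfin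
      rw [← ENNReal.tsum_add, ← ENNReal.tsum_add]
      refine ENNReal.tsum_lt_tsum (i := s) hfin (fun u => ?_) ?_
      · have := lump_trade_off (q := q) (y := y) hc hd.mono u
        rwa [hexc, mul_zero, ENNReal.ofReal_zero, add_zero] at this
      · rw [ht, if_neg (lt_irrefl _), if_pos hs, mul_zero, ENNReal.ofReal_zero, zero_add, add_zero]
        have hw := Real.exp_pos (-q * s)
        exact (ENNReal.ofReal_lt_ofReal_iff (mul_pos hw hc)).2 (mul_lt_mul_of_pos_left hlt hw)
    exact hlt'.ne hs1

/-- If a lump sum of exactly `c` is paid before time `t` and minimal injection for the trimmed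
dividends is also minimal for the untrimmed ones, then the path never falls below
`-reg d y t`. -/
lemma le_reg_of_lump_eq (hc : 0 < c) (hd : IsDividendPath d) (hy : IsCadlagPath y)
    (hreg : reg d y = reg (jumpSum (trimmed c d y)) y) {s t u : ℝ≥0} (hst : s < t)
    (hs : jumpAt d s = c) : -y u ≤ reg d y t := by
  have hp := isJumpFamily_trimmed hc hd hy
  have hle := trimmed_le_jumpAt (c := c) hd.mono hy
  by_contra! hcon
  have h1 : reg d y t < reg d y u := by
    have h2 := le_reg hd.mono hy (le_refl u)
    have h3 := hd.nonneg u
    linarith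
  -- The lump of size `c` at `s < t` is removed by trimming, so from `t` on the trimmed dividends
  -- lag by at least `c`.
  have h4 : ∀ v, t ≤ v → jumpSum (trimmed c d y) v ≤ d v - c := by
    intro v hv
    have hq : IsJumpFamily fun s => jumpAt d s - trimmed c d y s :=
      hd.isJumpFamily.of_le (fun s => sub_nonneg.2 (hle s)) fun s => sub_le_self _
        (trimmed_nonneg hc s)
    have h5 := hq.jumpSum_add hp v
    simp only [sub_add_cancel] at h5
    rw [show (fun s => jumpAt d s) = jumpAt d from rfl, hd.jumpSum_jumpAt] at h5
    have h6 : c ≤ jumpSum (fun s => jumpAt d s - trimmed c d y s) v := by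
      refine le_trans ?_ ((hq.summable v).le_tsum s fun i _ =>
        indicator_nonneg (fun i _ => hq.nonneg i) i)
      rw [indicator_of_mem (by exact hst.trans_le hv)]
      have h7 : trimmed c d y s = 0 :=
        if_neg (by have := excess_nonneg (d := d) (y := y) s; rw [hs]; linarith)
      rw [hs, h7, sub_zero]
    linarith
  -- Both bounds lie strictly below `reg d y u`, so trimming would strictly reduce the injections by
  -- time `u`, against `hreg`.
  have h8 : reg (jumpSum (trimmed c d y)) y u ≤ max (reg d y t) (reg d y u - c) := by
    refine reg_le (le_max_of_le_left (reg_nonneg t)) fun v hv => ?_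
    rcases le_total v t with hvt | hvt
    · refine le_max_of_le_left (le_trans ?_ (le_reg hd.mono hy hvt))
      exact sub_le_sub_right (jumpSum_le hd hp hle v) _
    · refine le_max_of_le_right ?_
      have h9 := h4 v hvt
      have h10 := le_reg hd.mono hy hv
      linarith
  rw [← hreg] at h8
  rcases le_max_iff.1 h8 with h | h <;> linarith

lemma jumpSum_trimmed_eq (hd : IsDividendPath d) (hexc : ∀ s, excess d y s = 0)
    (hjump : ∀ s, 0 < jumpAt d s → c ≤ jumpAt d s) (hne : ∀ s, jumpAt d s ≠ c) :
    jumpSum (trimmed c d y) = d := by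
  conv_rhs => rw [← hd.jumpSum_jumpAt]
  congr 1
  ext s
  rw [trimmed, hexc, sub_zero]
  split_ifs with h
  · rfl
  · by_contra hne0
    have h1 := hjump s (lt_of_le_of_ne (jumpAt_nonneg hd.mono s) hne0)
    exact hne s (le_antisymm (not_lt.1 h) h1)

end Compare

/-- An uncountable union of events, detected by whether the sum of the jumps equal to `c` is
nonzero; `c > 0` makes each such jump count. -/
lemma measurableSet_exists_jumpAt_eq {Ω : Type*} {m : MeasurableSpace Ω} {d : ℝ≥0 → Ω → ℝ} {c : ℝ}
    (hc : 0 < c) {t : ℝ≥0} (hd : ∀ s ≤ t, Measurable (d s))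
    (hp : ∀ ω, IsDividendPath fun s => d s ω) :
    MeasurableSet {ω | ∃ s < t, jumpAt (fun s => d s ω) s = c} := by
  classical
  let d' : ℝ≥0 → Ω → ℝ := fun s ω => d (min s t) ω
  have hd' : ∀ s, Measurable (d' s) := fun s => hd _ (min_le_right _ _)
  have hp' : ∀ ω, IsDividendPath fun s => d' s ω := fun ω => (hp ω).stopped t
  have h1 := measurable_uncurry_jumpAt hd' hp'
  have h2 := measurable_tsum_indicator_jumpAt_mul hd' hp'
    (h := fun s ω => if jumpAt (fun s => d' s ω) s = c then 1 else 0)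
    (Measurable.ite (h1 (measurableSet_singleton c)) measurable_const measurable_const) t
  convert! (h2 (measurableSet_singleton 0)).compl using 1
  ext ω
  have hj : ∀ s < t, jumpAt (fun s => d' s ω) s = jumpAt (fun s => d s ω) s := fun s hs => by
    rw [(hp ω).jumpAt_stopped t, indicator_of_mem (by exact hs)]
  change (∃ s < t, _) ↔ ¬ (_ = (0 : ℝ≥0∞))
  rw [ENNReal.tsum_eq_zero, not_forall]
  refine exists_congr fun s => ?_
  by_cases hs : s < t
  · simp only [hs, true_and, mem_Iio, indicator_of_mem, hj s hs]
    constructor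
    · rintro h
      simp [h, hc]
    · intro h
      by_contra hne
      exact h (by simp [hne])
  · simp [hs]

/-! ### Strategies and their values -/

section Value

variable {Ω : Type*} [mΩ : MeasurableSpace Ω] {P : Measure Ω} {X : ℝ≥0 → Ω → ℝ} {x q c φ : ℝ}

namespace Strategy

variable {𝓕 : Filtration ℝ≥0 mΩ}

lemma isDividendPath (S : Strategy 𝓕) (ω : Ω) : IsDividendPath fun s => S.D s ω :=
  ⟨S.D_zero ω, S.D_mono ω, S.D_left_continuous ω, S.D_pure_jump ω⟩

/-- The total discounted cost of a strategy. -/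
def outflow (S : Strategy 𝓕) (q c φ : ℝ) (ω : Ω) : ℝ≥0∞ :=
  S.discountedCosts q c ω + ENNReal.ofReal φ * S.discountedInjection q ω

lemma discountedDividends_eq (S : Strategy 𝓕) (q : ℝ) (ω : Ω) :
    S.discountedDividends q ω = pathDividends q fun s => S.D s ω := rfl

lemma discountedCosts_eq (S : Strategy 𝓕) (q c : ℝ) (ω : Ω) :
    S.discountedCosts q c ω = pathCosts q c fun s => S.D s ω := rfl

lemma discountedInjection_eq (S : Strategy 𝓕) (hq : 0 < q) (ω : Ω) :
    S.discountedInjection q ω = pathInjection q fun s => S.R s ω :=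
  lintegral_exp_stieltjes hq (S.injection ω) (S.R_zero ω)

lemma measurable_D (S : Strategy 𝓕) (t : ℝ≥0) : Measurable (S.D t) :=
  (S.D_adapted t).mono (𝓕.le t) le_rfl

lemma measurable_R (S : Strategy 𝓕) (t : ℝ≥0) : Measurable (S.R t) :=
  (S.R_adapted t).mono (𝓕.le t) le_rfl

lemma measurable_discountedDividends (S : Strategy 𝓕) (q : ℝ) :
    Measurable (S.discountedDividends q) := by
  have h := measurable_tsum_jumpAt_mul S.measurable_D S.isDividendPath
    (h := fun s _ => ENNReal.ofReal (Real.exp (-q * s))) (by fun_prop)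
  convert! h using 2 with ω
  refine tsum_congr fun s => ?_
  rw [mul_comm, ENNReal.ofReal_mul' (Real.exp_nonneg _)]
  rfl

lemma measurable_discountedCosts (S : Strategy 𝓕) (q c : ℝ) :
    Measurable (S.discountedCosts q c) := by
  have h1 := measurable_uncurry_jumpAt S.measurable_D S.isDividendPath
  have h := measurable_tsum_jumpAt_mul S.measurable_D S.isDividendPath
    (h := fun s ω => ENNReal.ofReal (Real.exp (-q * s) * c)
      / ENNReal.ofReal (jumpAt (fun s => S.D s ω) s))
    (Measurable.div (by fun_prop) h1.ennreal_ofReal)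
  convert! h using 2 with ω
  refine tsum_congr fun s => ?_
  change (if 0 < jumpAt (fun s => S.D s ω) s then _ else _) = _
  split_ifs with h0
  · rw [ENNReal.mul_div_cancel (by simpa using h0) ENNReal.ofReal_ne_top]
  · rw [ENNReal.ofReal_eq_zero.2 (not_lt.1 h0), zero_mul]

lemma measurable_discountedInjection (S : Strategy 𝓕) (hq : 0 < q) :
    Measurable (S.discountedInjection q) := by
  have := isProbabilityMeasure_discountMeasure hq
  have h1 : S.discountedInjection q
      = fun ω => ∫⁻ t, ENNReal.ofReal (S.R t ω) ∂discountMeasure q :=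
    funext fun ω => S.discountedInjection_eq hq ω
  rw [h1]
  have h2 := measurable_uncurry_of_right_continuous S.measurable_R S.R_right_continuous
  exact Measurable.lintegral_prod_left' (f := fun z : ℝ≥0 × Ω => ENNReal.ofReal (S.R z.1 z.2))
    h2.ennreal_ofReal

lemma measurable_outflow (S : Strategy 𝓕) (hq : 0 < q) (c φ : ℝ) :
    Measurable (S.outflow q c φ) :=
  (S.measurable_discountedCosts q c).add ((S.measurable_discountedInjection hq).const_mul _)

lemma toENNReal_payoff (S : Strategy 𝓕) (q c φ : ℝ) (ω : Ω) :
    (S.payoff q c φ ω).toENNReal = S.discountedDividends q ω - S.outflow q c φ ω := by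
  rw [payoff, EReal.toENNReal_sub (EReal.coe_ennreal_nonneg _), EReal.toENNReal_coe,
    EReal.toENNReal_coe]
  rfl

lemma toENNReal_neg_payoff (S : Strategy 𝓕) (q c φ : ℝ) {ω : Ω}
    (h : S.discountedDividends q ω ≠ ∞) :
    (-S.payoff q c φ ω).toENNReal = S.outflow q c φ ω - S.discountedDividends q ω := by
  have h1 : (S.discountedDividends q ω : EReal) ≠ ⊤ := by simpa using h
  have h2 : (S.discountedDividends q ω : EReal) ≠ ⊥ := EReal.coe_ennreal_ne_bot _
  rw [payoff, EReal.neg_sub (.inl h2) (.inl h1), add_comm, ← sub_eq_add_neg,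
    EReal.toENNReal_sub (EReal.coe_ennreal_nonneg _), EReal.toENNReal_coe, EReal.toENNReal_coe]
  rfl

lemma value_eq (S : Strategy 𝓕) (c φ : ℝ) (h : ∀ᵐ ω ∂P, S.discountedDividends q ω ≠ ∞) :
    S.value P q c φ
      = ((∫⁻ ω, (S.discountedDividends q ω - S.outflow q c φ ω) ∂P : ℝ≥0∞) : EReal)
        - ((∫⁻ ω, (S.outflow q c φ ω - S.discountedDividends q ω) ∂P : ℝ≥0∞) : EReal) := by
  rw [value]
  congr 2
  · exact lintegral_congr fun ω => S.toENNReal_payoff q c φ ω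
  · refine lintegral_congr_ae ?_
    filter_upwards [h] with ω hω using S.toENNReal_neg_payoff q c φ hω

/-- The strategy paying the feasible dividends `e` with minimal capital injections. -/
def ofDividends (hX : IsSpectrallyNegativeLevy X P x) (hx : 0 ≤ x) (e : ℝ≥0 → Ω → ℝ)
    (he : ∀ ω, IsDividendPath fun s => e s ω)
    (hm : ∀ t, Measurable[naturalFiltration X hX.measurable t] (e t))
    (hf : ∀ ω, IsFeasible (fun s => e s ω) fun s => X s ω) :
    Strategy (naturalFiltration X hX.measurable) where
  D := e
  R t ω := reg (fun s => e s ω) (fun s => X s ω) t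
  D_adapted := hm
  D_zero ω := (he ω).zero
  D_mono ω := (he ω).mono
  D_left_continuous ω := (he ω).left_continuous
  D_pure_jump ω := (he ω).pure_jump
  R_adapted t := measurable_reg
    (fun s hs => (hm s).mono ((naturalFiltration X hX.measurable).mono hs) le_rfl)
    (fun ω => (he ω).mono) (fun s hs => measurable_naturalFiltration hX.measurable hs)
    hX.isCadlagPath
  R_zero ω := reg_zero (he ω).zero (by rw [hX.start]; exact hx)
  R_mono ω := reg_mono (he ω).mono (hX.isCadlagPath ω)
  R_right_continuous ω t := reg_right_continuous (he ω).mono (hX.isCadlagPath ω)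
    ((hf ω).rightLim_sub_le (he ω).mono (hX.isCadlagPath ω) t)

lemma ofDividends_isReflected (hX : IsSpectrallyNegativeLevy X P x) (hx : 0 ≤ x)
    {e : ℝ≥0 → Ω → ℝ} (he : ∀ ω, IsDividendPath fun s => e s ω)
    (hm : ∀ t, Measurable[naturalFiltration X hX.measurable t] (e t))
    (hf : ∀ ω, IsFeasible (fun s => e s ω) fun s => X s ω) (hc : 0 < c)
    (hlump : ∀ ω t, 0 < jumpAt (fun s => e s ω) t → c < jumpAt (fun s => e s ω) t)
    (hfin : ∀ᵐ ω ∂P, (ofDividends hX hx e he hm hf).discountedInjection q ω < ∞) :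
    (ofDividends hX hx e he hm hf).IsReflected X P q c := by
  refine ⟨?_, ae_of_all _ fun ω t => ⟨?_, rfl⟩⟩
  · filter_upwards [hfin] with ω hω
    refine ⟨fun t => ?_, hω⟩
    have h1 := le_reg (he ω).mono (hX.isCadlagPath ω) (le_refl t)
    change 0 ≤ X t ω - e t ω + reg (fun s => e s ω) (fun s => X s ω) t
    linarith
  · have h1 := leftLim_reserve_add_jump (he ω).left_continuous (hX.isCadlagPath ω)
      (reg_mono (he ω).mono (hX.isCadlagPath ω)) t
    have h2 := hf ω t
    rw [← h1] at h2
    exact ⟨fun h => ⟨hlump ω t h, h2 h⟩, fun h => hc.trans h.1⟩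

lemma IsReflected.congr {S S' : Strategy 𝓕} (hS' : S'.IsReflected X P q c)
    (hS : S.IsAdmissible X P q) (h : ∀ᵐ ω ∂P, ∀ t, S.D t ω = S'.D t ω ∧ S.R t ω = S'.R t ω) :
    S.IsReflected X P q c := by
  refine ⟨hS, ?_⟩
  filter_upwards [hS'.2, h] with ω h1 h2 t
  have hD : (fun s => S.D s ω) = fun s => S'.D s ω := funext fun s => (h2 s).1
  have hR : (fun s => S.R s ω) = fun s => S'.R s ω := funext fun s => (h2 s).2
  have hU : (fun s => S.reserve X s ω) = fun s => S'.reserve X s ω :=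
    funext fun s => by simp only [reserve, (h2 s).1, (h2 s).2]
  have hl : S.lump t ω = S'.lump t ω := by rw [lump, lump, hD, (h2 t).1]
  have hsub : (fun s => X s ω - S.D s ω) = fun s => X s ω - S'.D s ω :=
    funext fun s => by rw [(h2 s).1]
  rw [hl, hU, hsub, (h2 t).2]
  exact h1 t

end Strategy

/-- Equal positive and negative parts of two payoffs mean equal payoffs, written without
subtraction. -/
lemma ENNReal_add_eq_add_of_sub_eq {a b a' b' : ℝ≥0∞} (h1 : a - b = a' - b')
    (h2 : b - a = b' - a') (ha : a ≠ ∞) (hb : b ≠ ∞) : a + b' = a' + b := by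
  have h3 : a - b + b = b - a + a := by rw [tsub_add_eq_max, tsub_add_eq_max, max_comm]
  have h4 : a' - b' + b' = b' - a' + a' := by rw [tsub_add_eq_max, tsub_add_eq_max, max_comm]
  rw [← h1, ← h2] at h4
  have hu : a - b ≠ ∞ := ne_top_of_le_ne_top ha tsub_le_self
  have hv : b - a ≠ ∞ := ne_top_of_le_ne_top hb tsub_le_self
  have h5 : (a - b) + (b - a) + (a + b') = (a - b) + (b - a) + (a' + b) := by
    calc (a - b) + (b - a) + (a + b') = (b - a + a) + (a - b + b') := by ring
      _ = (a - b + b) + (b - a + a') := by rw [← h3, h4]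
      _ = _ := by ring
  exact (ENNReal.add_right_inj (ENNReal.add_ne_top.2 ⟨hu, hv⟩)).1 h5

lemma EReal_sub_lt_sub {p n p' n' : ℝ≥0∞} (hp' : p' ≠ ∞) (hn : n ≠ ∞) (hpp : p ≤ p')
    (hnn : n' ≤ n) (hne : ¬ (p = p' ∧ n = n')) : (p : EReal) - n < (p' : EReal) - n' := by
  have hp := ne_top_of_le_ne_top hp' hpp
  have hn' := ne_top_of_le_ne_top hn hnn
  lift p to ℝ≥0 using hp
  lift n to ℝ≥0 using hn
  lift p' to ℝ≥0 using hp'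
  lift n' to ℝ≥0 using hn'
  rw [ENNReal.coe_le_coe, ← NNReal.coe_le_coe] at hpp hnn
  have h1 : ∀ z : ℝ≥0, ((z : ℝ≥0∞) : EReal) = ((z : ℝ) : EReal) := fun z => rfl
  rw [h1, h1, h1, h1, ← EReal.coe_sub, ← EReal.coe_sub, EReal.coe_lt_coe_iff]
  by_contra hcon
  refine hne ⟨?_, ?_⟩ <;> rw [ENNReal.coe_inj, ← NNReal.coe_inj] <;> linarith

end Value

/-! ### Domination by reflected strategies -/

section Domination

variable {Ω : Type*} [mΩ : MeasurableSpace Ω] {P : Measure Ω} {X : ℝ≥0 → Ω → ℝ} {x q c φ : ℝ}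

lemma isJumpFamily_zero : IsJumpFamily fun _ => 0 :=
  ⟨fun _ => le_rfl, fun t => by simp⟩

namespace Strategy

/-- The strategy that never pays dividends and injects capital minimally. -/
def noDividends (hX : IsSpectrallyNegativeLevy X P x) (hx : 0 ≤ x) :
    Strategy (naturalFiltration X hX.measurable) :=
  ofDividends hX hx (fun t _ => jumpSum (fun _ => 0) t) (fun _ => isJumpFamily_zero.isDividendPath)
    (fun _ => measurable_const) fun ω t ht => by
      rw [isJumpFamily_zero.jumpAt_jumpSum] at ht
      exact absurd ht (lt_irrefl _)

/-- The strategy obtained by trimming all lump sum dividends, with minimal capital injections. -/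
def trim (hX : IsSpectrallyNegativeLevy X P x) (hx : 0 ≤ x) (hc : 0 < c)
    (S : Strategy (naturalFiltration X hX.measurable)) :
    Strategy (naturalFiltration X hX.measurable) :=
  ofDividends hX hx (fun t ω => jumpSum (trimmed c (fun s => S.D s ω) fun s => X s ω) t)
    (fun ω => (isJumpFamily_trimmed hc (S.isDividendPath ω) (hX.isCadlagPath ω)).isDividendPath)
    (fun _ => measurable_jumpSum_trimmed hc
      (fun s hs => (S.D_adapted s).mono ((naturalFiltration X hX.measurable).mono hs) le_rfl)
      S.isDividendPath (fun _ hs => measurable_naturalFiltration hX.measurable hs) hX.isCadlagPath)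
    fun ω => isFeasible_trimmed hc (S.isDividendPath ω) (hX.isCadlagPath ω)

lemma discountedInjection_noDividends_le (hX : IsSpectrallyNegativeLevy X P x) (hx : 0 ≤ x)
    (hq : 0 < q) {g : ℝ≥0 → Ω → ℝ≥0∞}
    (hg : ∀ ω s t, s ≤ t → ENNReal.ofReal |X s ω| ≤ g t ω) (ω : Ω) :
    (noDividends hX hx).discountedInjection q ω ≤ ∫⁻ t, g t ω ∂discountMeasure q := by
  rw [discountedInjection_eq _ hq]
  refine lintegral_mono fun t => ?_
  rcases eq_or_ne (g t ω) ∞ with h | h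
  · rw [h]
    exact le_top
  rw [ENNReal.ofReal_le_iff_le_toReal h]
  refine reg_le ENNReal.toReal_nonneg fun s hs => ?_
  have h1 := (ENNReal.ofReal_le_iff_le_toReal h).1 (hg ω s t hs)
  have h2 : jumpSum (fun _ => 0) s = 0 := by simp [jumpSum]
  change jumpSum (fun _ => 0) s - X s ω ≤ _
  rw [h2, zero_sub]
  exact (neg_le_abs _).trans h1

lemma discountedDividends_noDividends (hX : IsSpectrallyNegativeLevy X P x) (hx : 0 ≤ x)
    (ω : Ω) :
    (noDividends hX hx).discountedDividends q ω = 0 := by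
  rw [discountedDividends_eq]
  change pathDividends q (jumpSum fun _ => 0) = 0
  simp [pathDividends, isJumpFamily_zero.jumpAt_jumpSum]

lemma discountedCosts_noDividends (hX : IsSpectrallyNegativeLevy X P x) (hx : 0 ≤ x)
    (ω : Ω) :
    (noDividends hX hx).discountedCosts q c ω = 0 := by
  rw [discountedCosts_eq]
  change pathCosts q c (jumpSum fun _ => 0) = 0
  simp [pathCosts, isJumpFamily_zero.jumpAt_jumpSum]

lemma noDividends_isReflected [IsProbabilityMeasure P] (hX : IsSpectrallyNegativeLevy X P x)
    (hx : 0 ≤ x) (hmean : Integrable (X 1) P) (hq : 0 < q) (hc : 0 < c) :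
    (noDividends hX hx).IsReflected X P q c := by
  obtain ⟨g, hg, -, hgm, hgi⟩ := hX.exists_discounted_bound hmean hq
  refine ofDividends_isReflected hX hx _ _ _ hc (fun ω t ht => ?_) ?_
  · rw [isJumpFamily_zero.jumpAt_jumpSum] at ht
    exact absurd ht (lt_irrefl _)
  · filter_upwards [ae_lt_top hgm hgi] with ω hω
    exact (discountedInjection_noDividends_le hX hx hq hg ω).trans_lt hω

lemma bot_lt_value_noDividends [IsProbabilityMeasure P] (hX : IsSpectrallyNegativeLevy X P x)
    (hx : 0 ≤ x) (hmean : Integrable (X 1) P) (hq : 0 < q) :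
    ⊥ < (noDividends hX hx).value P q c φ := by
  obtain ⟨g, hg, -, hgm, hgi⟩ := hX.exists_discounted_bound hmean hq
  rw [value_eq _ _ _ (ae_of_all _ fun ω => by rw [discountedDividends_noDividends]; simp)]
  simp only [outflow, discountedDividends_noDividends, discountedCosts_noDividends, zero_tsub,
    tsub_zero, zero_add, lintegral_zero]
  have h1 : ∫⁻ ω, ENNReal.ofReal φ * (noDividends hX hx).discountedInjection q ω ∂P ≠ ∞ := by
    rw [lintegral_const_mul' _ _ ENNReal.ofReal_ne_top]
    exact ENNReal.mul_ne_top ENNReal.ofReal_ne_top (ne_top_of_le_ne_top hgi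
      (lintegral_mono fun ω => discountedInjection_noDividends_le hX hx hq hg ω))
  lift (∫⁻ ω, ENNReal.ofReal φ * (noDividends hX hx).discountedInjection q ω ∂P) to ℝ≥0
    using h1 with z
  change ⊥ < ((0 : ℝ≥0∞) : EReal) - ((z : ℝ) : EReal)
  rw [EReal.coe_ennreal_zero, zero_sub, ← EReal.coe_neg]
  exact EReal.bot_lt_coe _

/-- A nonnegative reserve means `D ≤ X + R`. As `φ > 1`, the term in `R` is later absorbed by the
cost of injections. -/
lemma discountedDividends_le (hX : IsSpectrallyNegativeLevy X P x) (hq : 0 < q) {g : ℝ≥0 → Ω → ℝ≥0∞}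
    (hg : ∀ ω s t, s ≤ t → ENNReal.ofReal |X s ω| ≤ g t ω) (hgm : ∀ ω, Measurable fun t => g t ω)
    (S : Strategy (naturalFiltration X hX.measurable)) {ω : Ω} (h : ∀ t, 0 ≤ S.reserve X t ω) :
    S.discountedDividends q ω
      ≤ ∫⁻ t, g t ω ∂discountMeasure q + S.discountedInjection q ω := by
  rw [discountedDividends_eq, (S.isDividendPath ω).pathDividends_eq hq, discountedInjection_eq _ hq,
    pathInjection, ← lintegral_add_left (hgm ω)]
  refine lintegral_mono fun t => ?_
  have hR : 0 ≤ S.R t ω := S.R_zero ω ▸ S.R_mono ω zero_le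
  refine le_trans ?_ (add_le_add_left (hg ω t t le_rfl) _)
  rw [← ENNReal.ofReal_add (abs_nonneg _) hR]
  refine ENNReal.ofReal_le_ofReal ?_
  have h1 := h t
  rw [reserve] at h1
  linarith [le_abs_self (X t ω)]

/-- Lump sums of exactly `c` do not occur if trimming them leaves the injections unchanged. -/
lemma ae_jumpAt_ne [IsProbabilityMeasure P] (hX : IsSpectrallyNegativeLevy X P x)
    (hmean : Integrable (X 1) P) (hc : 0 < c) (S : Strategy (naturalFiltration X hX.measurable))
    (h : ∀ᵐ ω ∂P, reg (fun s => S.D s ω) (fun s => X s ω)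
      = reg (jumpSum (trimmed c (fun s => S.D s ω) fun s => X s ω)) fun s => X s ω) :
    ∀ᵐ ω ∂P, ∀ s, jumpAt (fun s => S.D s ω) s ≠ c := by
  -- Using deterministic times from a dense sequence makes each event known at a fixed time and
  -- avoids stopping times.
  let N : ℕ → Set Ω := fun i => {ω | ∃ s < TopologicalSpace.denseSeq ℝ≥0 i,
    jumpAt (fun s => S.D s ω) s = c}
  have hN : ∀ i, P (N i) = 0 := by
    intro i
    set t := TopologicalSpace.denseSeq ℝ≥0 i
    have hDm : ∀ s ≤ t, Measurable[naturalFiltration X hX.measurable t] (S.D s) := fun s hs =>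
      (S.D_adapted s).mono ((naturalFiltration X hX.measurable).mono hs) le_rfl
    have hXm : ∀ s ≤ t, Measurable[naturalFiltration X hX.measurable t] (X s) := fun s hs =>
      measurable_naturalFiltration hX.measurable hs
    have hNm : MeasurableSet[naturalFiltration X hX.measurable t] (N i) :=
      measurableSet_exists_jumpAt_eq hc hDm S.isDividendPath
    have hregm := measurable_reg hDm S.D_mono hXm hX.isCadlagPath
    -- `A k` is known at time `t`, hence independent of a later fall by more than `k`. On `A k` such
    -- a fall brings `X` below `-reg` at time `t`, which `le_reg_of_lump_eq` forbids; since the fall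
    -- has positive probability, `A k` is null.
    let A : ℕ → Set Ω := fun k =>
      N i ∩ (fun ω => X t ω + reg (fun s => S.D s ω) (fun s => X s ω) t) ⁻¹' Iic (k : ℝ)
    have hA : ∀ k, P (A k) = 0 := by
      intro k
      obtain ⟨T, hT⟩ := hX.exists_measure_increment_lt_pos hmean (-k)
      have h1 := measure_inter_increment (A := A k) hX.measurable hX.start hX.indep_increments
        (le_add_of_nonneg_right (a := t) (zero_le (a := T)))
        (hNm.inter (((hXm t le_rfl).add hregm) (measurableSet_Iic (a := (k : ℝ)))))
        (measurableSet_Iio (a := -(k : ℝ)))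
      have h2 : P (A k ∩ {ω | X (t + T) ω - X t ω ∈ Iio (-(k : ℝ))}) = 0 := by
        refine measure_mono_null (fun ω hω => ?_) h
        obtain ⟨⟨⟨s, hs, hsc⟩, h3⟩, h4⟩ := hω
        have h3' : X t ω + reg (fun s => S.D s ω) (fun s => X s ω) t ≤ k := h3
        have h4' : X (t + T) ω - X t ω < -k := h4
        intro h5
        have h6 := le_reg_of_lump_eq (u := t + T) hc (S.isDividendPath ω) (hX.isCadlagPath ω) h5
          hs hsc
        linarith
      rw [h2, eq_comm, mul_eq_zero] at h1
      exact h1.resolve_right (hT t).ne'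
    refine measure_mono_null (fun ω hω => ?_) (measure_iUnion_null hA)
    obtain ⟨k, hk⟩ := exists_nat_ge (X t ω + reg (fun s => S.D s ω) (fun s => X s ω) t)
    exact mem_iUnion.2 ⟨k, hω, hk⟩
  refine measure_mono_null (fun ω hω => ?_) (measure_iUnion_null hN)
  have h1 : ¬ ∀ s, jumpAt (fun s => S.D s ω) s ≠ c := hω
  push Not at h1
  obtain ⟨s, hs⟩ := h1
  obtain ⟨_, ⟨i, rfl⟩, hi, -⟩ := (TopologicalSpace.denseRange_denseSeq ℝ≥0).exists_between
    (lt_add_one s)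
  exact mem_iUnion.2 ⟨i, s, hi, hs⟩

/-- Every admissible strategy that is not reflected is strictly dominated by a reflected one. -/
theorem exists_isReflected_value_lt [IsProbabilityMeasure P] (hX : IsSpectrallyNegativeLevy X P x)
    (hx : 0 ≤ x) (hmean : Integrable (X 1) P) (hq : 0 < q) (hc : 0 < c) (hφ : 1 < φ)
    (S : Strategy (naturalFiltration X hX.measurable)) (hS : S.IsAdmissible X P q)
    (hS' : ¬ S.IsReflected X P q c) :
    ∃ S' : Strategy (naturalFiltration X hX.measurable), S'.IsReflected X P q c ∧
      S.value P q c φ < S'.value P q c φ := by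
  obtain ⟨g, hg, hgm, hgM, hgi⟩ := hX.exists_discounted_bound hmean hq
  have hS0 : ∀ ω, 0 ≤ X 0 ω := fun ω => by rw [hX.start]; exact hx
  have hdiv : ∀ S : Strategy (naturalFiltration X hX.measurable), S.IsAdmissible X P q →
      ∀ᵐ ω ∂P, S.discountedDividends q ω ≠ ∞ := fun S hS => by
    filter_upwards [hS, ae_lt_top hgM hgi] with ω hω hω'
    exact ne_top_of_le_ne_top (ENNReal.add_ne_top.2 ⟨hω'.ne, hω.2.ne⟩)
      (S.discountedDividends_le hX hq hg hgm hω.1)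
  have hpos : ∀ S : Strategy (naturalFiltration X hX.measurable), S.IsAdmissible X P q →
      ∫⁻ ω, (S.discountedDividends q ω - S.outflow q c φ ω) ∂P ≠ ∞ := fun S hS => by
    refine ne_top_of_le_ne_top hgi (lintegral_mono_ae ?_)
    filter_upwards [hS] with ω hω
    rw [tsub_le_iff_right]
    refine (S.discountedDividends_le hX hq hg hgm hω.1).trans (add_le_add_right ?_ _)
    exact (le_mul_of_one_le_left zero_le (ENNReal.one_le_ofReal.2 hφ.le)).trans le_add_self
  -- In this case the value is `-∞`, and trimming need not give a strict improvement; the strategy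
  -- without dividends has value above `-∞`.
  by_cases hneg : ∫⁻ ω, (S.outflow q c φ ω - S.discountedDividends q ω) ∂P = ∞
  · refine ⟨noDividends hX hx, noDividends_isReflected hX hx hmean hq hc, ?_⟩
    refine lt_of_eq_of_lt ?_ (bot_lt_value_noDividends hX hx hmean hq)
    rw [S.value_eq c φ (hdiv S hS), hneg, EReal.coe_ennreal_top, EReal.sub_top]
  have hout : ∀ᵐ ω ∂P, S.outflow q c φ ω ≠ ∞ := by
    filter_upwards [ae_lt_top ((S.measurable_outflow hq c φ).sub
      (S.measurable_discountedDividends q)) hneg, hdiv S hS] with ω h1 h2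
    exact ne_top_of_le_ne_top (ENNReal.add_ne_top.2 ⟨h1.ne, h2⟩) le_tsub_add
  set S₁ := trim hX hx hc S with hS₁
  have hinj : ∀ᵐ ω ∂P, S₁.discountedInjection q ω < ∞ := by
    filter_upwards [hS] with ω hω
    have h1 := tsum_excess_add_le hq hc (S.isDividendPath ω) (hX.isCadlagPath ω) (hS0 ω)
      (S.R_mono ω) (S.R_zero ω) hω.1
    rw [← S.discountedInjection_eq hq] at h1
    rw [S₁.discountedInjection_eq hq]
    exact (le_add_self.trans h1).trans_lt hω.2
  have href : S₁.IsReflected X P q c :=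
    ofDividends_isReflected hX hx _ _ _ hc (fun ω t ht => by
      rw [(isJumpFamily_trimmed hc (S.isDividendPath ω)
        (hX.isCadlagPath ω)).jumpAt_jumpSum] at ht ⊢
      exact lt_trimmed_of_pos ht) hinj
  refine ⟨S₁, href, ?_⟩
  have hcmp : ∀ᵐ ω ∂P, S.discountedDividends q ω + S₁.outflow q c φ ω
      ≤ S₁.discountedDividends q ω + S.outflow q c φ ω := by
    filter_upwards [hS] with ω hω
    have h1 := payoff_trimmed_le hq hc hφ (S.isDividendPath ω) (hX.isCadlagPath ω) (hS0 ω)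
      (S.R_mono ω) (S.R_zero ω) hω.1
    rw [← S.discountedInjection_eq hq] at h1
    rw [outflow, outflow, S₁.discountedInjection_eq hq]
    exact h1
  have hdiv₁ := hdiv S₁ href.1
  have hle1 : ∀ᵐ ω ∂P, S.discountedDividends q ω - S.outflow q c φ ω
      ≤ S₁.discountedDividends q ω - S₁.outflow q c φ ω := by
    filter_upwards [hcmp, hout, hdiv S hS, hdiv₁] with ω h1 h2 h3 h4
    have h5 : S₁.outflow q c φ ω ≠ ∞ :=
      ne_top_of_le_ne_top (ENNReal.add_ne_top.2 ⟨h4, h2⟩) (le_add_self.trans h1)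
    rcases le_total (S.discountedDividends q ω) (S.outflow q c φ ω) with h6 | h6
    · rw [tsub_eq_zero_of_le h6]
      exact zero_le
    · refine ENNReal.le_sub_of_add_le_right h5 ?_
      refine (ENNReal.add_le_add_iff_right h2).1 ?_
      rwa [add_right_comm, tsub_add_cancel_of_le h6]
  have hle2 : ∀ᵐ ω ∂P, S₁.outflow q c φ ω - S₁.discountedDividends q ω
      ≤ S.outflow q c φ ω - S.discountedDividends q ω := by
    filter_upwards [hcmp, hdiv S hS] with ω h1 h3
    rw [tsub_le_iff_right]
    refine (ENNReal.add_le_add_iff_left h3).1 (h1.trans ?_)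
    rw [← add_assoc, add_comm]
    exact add_le_add_left le_add_tsub _
  rw [S.value_eq c φ (hdiv S hS), S₁.value_eq c φ hdiv₁]
  refine EReal_sub_lt_sub (hpos S₁ href.1) hneg (lintegral_mono_ae hle1) (lintegral_mono_ae hle2)
    fun ⟨h1, h2⟩ => hS' ?_
  have hm := (S.measurable_outflow hq c φ).sub (S.measurable_discountedDividends q)
  have hm₁ := (S₁.measurable_discountedDividends q).sub (S₁.measurable_outflow hq c φ)
  -- If both expectations agree, the almost sure inequalities between the positive and negative
  -- parts are almost sure equalities.
  have he1 := ae_eq_of_ae_le_of_lintegral_le hle1 (hpos S hS) hm₁.aemeasurable h1.ge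
  have he2 := ae_eq_of_ae_le_of_lintegral_le hle2 (h2 ▸ hneg) hm.aemeasurable h2.le
  have hpath : ∀ᵐ ω ∂P, (fun s => S.R s ω) = reg (jumpSum (trimmed c (fun s => S.D s ω)
        fun s => X s ω)) (fun s => X s ω) ∧
      (∀ s, excess (fun s => S.D s ω) (fun s => X s ω) s = 0) ∧
      ∀ s, 0 < jumpAt (fun s => S.D s ω) s → c ≤ jumpAt (fun s => S.D s ω) s := by
    filter_upwards [he1, he2, hout, hdiv S hS, hS] with ω h3 h4 h5 h6 h7
    have h8 := ENNReal_add_eq_add_of_sub_eq h3 h4.symm h6 h5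
    rw [outflow, outflow, S₁.discountedInjection_eq hq, S.discountedInjection_eq hq] at h8
    refine eq_of_payoff_eq hq hc hφ (S.isDividendPath ω) (hX.isCadlagPath ω) (hS0 ω)
      (S.R_mono ω) (S.R_zero ω) (S.R_right_continuous ω) h7.1 h6 ?_ ?_ h8
    · exact ne_top_of_le_ne_top h5 le_self_add
    · rw [← S.discountedInjection_eq hq]
      exact h7.2.ne
  have hregeq : ∀ᵐ ω ∂P, reg (fun s => S.D s ω) (fun s => X s ω)
      = reg (jumpSum (trimmed c (fun s => S.D s ω) fun s => X s ω)) fun s => X s ω := by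
    filter_upwards [hpath, hS] with ω h3 h4
    ext t
    -- The original minimal injection is at most `R`, which equals the minimal injection for the
    -- trimmed dividends, and trimming never increases the latter.
    refine le_antisymm ?_ ?_
    · rw [← h3.1]
      exact reg_le_of_reserve_nonneg (S.R_mono ω) (S.R_zero ω) h4.1 t
    · have h5 := reg_trimmed_add_le hc (S.isDividendPath ω) (hX.isCadlagPath ω) (hS0 ω) t
      have h6 := (isJumpFamily_excess (S.isDividendPath ω) (hX.isCadlagPath ω)).jumpSum_nonneg t
      linarith
  refine href.congr hS ?_
  filter_upwards [hpath, ae_jumpAt_ne hX hmean hc S hregeq] with ω h3 h4 t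
  have h5 := jumpSum_trimmed_eq (S.isDividendPath ω) h3.2.1 h3.2.2 h4
  exact ⟨(congrFun h5 t).symm, congrFun h3.1 t⟩

end Strategy

end Domination

end ImpulseDividend

end

/-! ### Strict domination and its consequences for optimal strategies and the supremum -/

theorem mainTheorem8 {Ω : Type*} [MeasurableSpace Ω] (P : Measure Ω) [IsProbabilityMeasure P]
    (X : ℝ≥0 → Ω → ℝ) (x q c φ : ℝ) (hx : 0 ≤ x) (hq : 0 < q) (hc : 0 < c) (hφ : 1 < φ)
    (hX : ImpulseDividend.IsSpectrallyNegativeLevy X P x)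
    (hmean : Integrable (X 1) P)
    (𝓕 : Filtration ℝ≥0 ‹MeasurableSpace Ω›)
    (h𝓕 : 𝓕 = ImpulseDividend.naturalFiltration X hX.measurable) :
    (∀ S ∈ ImpulseDividend.admissibleClass 𝓕 X P q \ ImpulseDividend.reflectedClass 𝓕 X P q c,
      ∃ S' ∈ ImpulseDividend.reflectedClass 𝓕 X P q c, S.value P q c φ < S'.value P q c φ) ∧
    (∀ S ∈ ImpulseDividend.admissibleClass 𝓕 X P q,
      (∀ S' ∈ ImpulseDividend.admissibleClass 𝓕 X P q, S'.value P q c φ ≤ S.value P q c φ) →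
      S ∈ ImpulseDividend.reflectedClass 𝓕 X P q c) ∧
    (⨆ S ∈ ImpulseDividend.admissibleClass 𝓕 X P q, S.value P q c φ) =
      ⨆ S ∈ ImpulseDividend.reflectedClass 𝓕 X P q c, S.value P q c φ := by
  subst h𝓕
  have key : ∀ S ∈ ImpulseDividend.admissibleClass _ X P q \
      ImpulseDividend.reflectedClass _ X P q c,
      ∃ S' ∈ ImpulseDividend.reflectedClass (ImpulseDividend.naturalFiltration X hX.measurable)
        X P q c, S.value P q c φ < S'.value P q c φ := fun S hS =>
    ImpulseDividend.Strategy.exists_isReflected_value_lt hX hx hmean hq hc hφ S hS.1 hS.2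
  refine ⟨key, fun S hS hmax => ?_, le_antisymm (iSup₂_le fun S hS => ?_)
    (iSup₂_le fun S hS => le_iSup₂_of_le S hS.1 le_rfl)⟩
  · by_contra hnot
    obtain ⟨S', hS', hlt⟩ := key S ⟨hS, hnot⟩
    exact absurd (hmax S' hS'.1) (not_le.2 hlt)
  · by_cases hS' : S ∈ ImpulseDividend.reflectedClass _ X P q c
    · exact le_iSup₂_of_le S hS' le_rfl
    · obtain ⟨S', hS'', hlt⟩ := key S ⟨hS, hS'⟩
      exact le_iSup₂_of_le S' hS'' hlt.le
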